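/- Let $\varphi(y)=\sum_{j\ge 0}\varphi_j y^j$ be a power series with nonnegative real coefficients and radius of convergence $R\in(0,\infty]$, with $\varphi_0\neq 0$, with $\varphi_j\ne 0$ for some $j\ge 2$, and aperiodic, meaning that the integers $j$ with $\varphi_j\ne0$ generate $\mathbb Z$ as an additive group. Let $f$ be the power series satisfying $f(z)=z\,\varphi(f(z))$. For $0<y<R$ put $$\mu(\varphi;y)=\frac{y\varphi'(y)}{\varphi(y)},\qquad \sigma^2(\varphi;y)=\frac{y^2\varphi''(y)}{\varphi(y)}+\mu(\varphi;y)-\mu(\varphi;y)^2,$$ let $B=\sup_{0<y<R}\mu(\varphi;y)=\lim_{y\uparrow R}\mu(\varphi;y)\in(0,\infty]$ be the order of $\varphi$ at infinity, and let $I=\{\lambda\in(0,1): 1-\lambda<B\}$. Thus $I=(0,1)$ whenever $B\ge 1$, in particular whenever $\varphi$ has order $B\ge2$ at infinity; and $B\ge 2$ holds automatically if $R=\infty$. For every $\lambda\in I$ the equation $\mu(\varphi;y)=1-\lambda$ has a unique solution $y=y_\lambda\in(0,R)$, and $\sigma^2(\varphi;y_\lambda)>0$. With $\lambda=k/n$,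 $$[z^n]f(z)^k\;\sim\;\lambda\,\varphi(y_\lambda)^n\,y_\lambda^{k-n}\,\frac{1}{\sqrt{2\pi n\,\sigma^2(\varphi;y_\lambda)}}\;=\;\lambda(1-\lambda)^{-n}\varphi'(y_\lambda)^n\,\frac{y_\lambda^{k}}{\sqrt{2\pi n\,\sigma^2(\varphi;y_\lambda)}}$$ as $n\to\infty$, uniformly for $\lambda$ in each compact subset $K$ of $I$: for every such $K$ and every $\varepsilon>0$ there is $N$ such that for all $n\ge N$ and all $k\ge0$ with $k/n\in K$, the ratio of $[z^n]f(z)^k$ to the main term differs from $1$ by less than $\varepsilon$. -/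

import Mathlib

open Set

noncomputable section

namespace LagrangeBivariate

/-- The radius of convergence of the power series `v`, in `[0, ∞]`. -/
def radius (v : PowerSeries ℝ) : ENNReal :=
  (FormalMultilinearSeries.ofScalars ℝ (fun n : ℕ => PowerSeries.coeff n v)).radius

/-- The sum `v(y) = ∑ vⱼ yʲ`; it is only used for `0 < y < radius v`. -/
def eval (v : PowerSeries ℝ) (y : ℝ) : ℝ :=
  ∑' j : ℕ, PowerSeries.coeff j v * y ^ j

/-- `μ(v; y) = y v'(y) / v(y)`. -/
def mu (v : PowerSeries ℝ) (y : ℝ) : ℝ :=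
  y * deriv (eval v) y / eval v y

/-- `σ²(v; y) = y² v''(y) / v(y) + μ(v; y) - μ(v; y)²`. -/
def sigmaSq (v : PowerSeries ℝ) (y : ℝ) : ℝ :=
  y ^ 2 * deriv (deriv (eval v)) y / eval v y + mu v y - mu v y ^ 2

/-- Aperiodicity: the integer combinations of the exponents of `v` are all of `ℤ`. -/
def Aperiodic (v : PowerSeries ℝ) : Prop :=
  AddSubgroup.closure {m : ℤ | ∃ j : ℕ, PowerSeries.coeff j v ≠ 0 ∧ m = (j : ℤ)} = ⊤

/-- The order of `v` at infinity, that is the supremum of `μ(v; y)` over `0 < y < R`, where `R` is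
the radius of convergence. For nonnegative coefficients `μ(v; ·)` is nondecreasing on `(0, R)`,
so this is the limit of `μ(v; y)` as `y` increases to `R`. -/
def orderAtInfinity (v : PowerSeries ℝ) : EReal :=
  ⨆ y ∈ {y : ℝ | 0 < y ∧ ENNReal.ofReal y < radius v}, (mu v y : EReal)

/-- The parameters `t ∈ (0, 1)` with `1 - t` below the order of `v` at infinity; this is all of
`(0, 1)` as soon as that order is at least `1`. -/
def admissible (v : PowerSeries ℝ) : Set ℝ :=
  {t : ℝ | t ∈ Ioo (0 : ℝ) 1 ∧ ((1 - t : ℝ) : EReal) < orderAtInfinity v}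

/-- `y` is a positive solution of `μ(v; y) = 1 - t` inside the interval of convergence. -/
def IsPositiveSolution (v : PowerSeries ℝ) (t y : ℝ) : Prop :=
  0 < y ∧ ENNReal.ofReal y < radius v ∧ mu v y = 1 - t

end LagrangeBivariate

end

/-! For `0 < y < R` let `X` take the value `j` with probability `φⱼ yʲ / φ(y)`. Its mean is `μ(φ;
y)` and its variance `σ²(φ; y)`. Lagrange inversion gives `n [zⁿ] f^k = k [y^(n-k)] φⁿ`, and
`[y^(n-k)] φⁿ = φ(y)ⁿ y^(k-n) P(Sₙ = n - k)`, where `Sₙ` is a sum of `n` independent copies of `X`.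
At `y = y_λ` the mean of `Sₙ` is exactly `n - k`, so the claim is a local limit theorem at the mean:
`P(Sₙ = n - k) ∼ 1/√(2πnσ²)`.

The probability is a Fourier integral of the `n`-th power of the centered characteristic function
`χ`. Two bounds on `|θ| ≤ π` suffice: `|χ(θ)| ≤ exp(-cθ²)`, from aperiodicity
(`exists_norm_centeredCharFn_tilt_le`), and `χ(θ) = exp(-σ²θ²/2) + O(|θ|³)`, from the third moment
(`norm_centeredCharFn_sub_exp_le`). Since `|xⁿ - wⁿ| ≤ n |x - w| r^(n-1)`, they give an integral
error `O(1/n)` against a main term of order `n^(-1/2)` (`exists_norm_integral_pow_sub_le`).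

Uniformity: `y μ' = σ² > 0` makes `μ` strictly increasing, so a compact set of `λ` confines `y_λ` to
some `[a, b]` inside `(0, R)`, on which all constants can be chosen independently of `y`. -/

namespace LagrangeBivariate

open MeasureTheory Real

/-! ### Lagrange inversion for powers -/

/-- The Lagrange inversion formula for the powers of the solution of `f = X φ(f)`. -/
theorem natCast_mul_coeff_pow_of_eq_X_mul_subst {K : Type*} [Field K] [CharZero K]
    {φ f : PowerSeries K} (hf : f = PowerSeries.X * (PowerSeries.subst f φ : PowerSeries K)) :
    ∀ n k : ℕ, k ≤ n →
      (n : K) * PowerSeries.coeff n (f ^ k) = k * PowerSeries.coeff (n - k) (φ ^ n) := by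
  have hc : PowerSeries.constantCoeff f = 0 := by rw [hf]; simp
  have hs : PowerSeries.HasSubst f := PowerSeries.HasSubst.of_constantCoeff_zero' hc
  have hX : PowerSeries.X ∣ f := ⟨_, hf⟩
  intro n
  induction n using Nat.strong_induction_on with
  | _ n ih =>
    intro k hk
    rcases Nat.eq_zero_or_pos k with rfl | hk0
    · rcases Nat.eq_zero_or_pos n with rfl | hn0
      · simp
      · simp [PowerSeries.coeff_one, hn0.ne']
    obtain ⟨m, rfl⟩ := Nat.exists_eq_add_of_le' hk
    -- From `f^k = X^k · φ^k(f)`, the coefficient at `m + k` becomes a combination of coefficients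
    -- at `m < n` of powers of `f`, to which the induction hypothesis applies. Divisibility of `f`
    -- by `X` truncates the sum at `m`.
    have hfk : f ^ k = PowerSeries.X ^ k * (PowerSeries.subst f (φ ^ k) : PowerSeries K) := by
      rw [PowerSeries.subst_pow hs, ← mul_pow, ← hf]
    have hcoeff : PowerSeries.coeff (m + k) (f ^ k) =
        ∑ p ∈ Finset.HasAntidiagonal.antidiagonal m,
          PowerSeries.coeff p.1 (φ ^ k) * PowerSeries.coeff m (f ^ p.1) := by
      rw [hfk, PowerSeries.coeff_X_pow_mul, PowerSeries.coeff_subst' hs,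
        finsum_eq_sum_of_support_subset (s := Finset.range (m + 1))]
      · rw [Finset.Nat.sum_antidiagonal_eq_sum_range_succ_mk]
        simp
      · intro j hj
        by_contra hjm
        apply hj
        have : PowerSeries.coeff m (f ^ j) = 0 :=
          PowerSeries.X_pow_dvd_iff.1 (pow_dvd_pow_of_dvd hX j) m (by simpa using hjm)
        simp [this]
    rw [hcoeff, Nat.add_sub_cancel]
    rcases Nat.eq_zero_or_pos m with rfl | hm
    · simp
    -- The induction hypothesis carries the factor `m`, so the identity is proved after
    -- multiplication by `m`.
    have hm' : (m : K) ≠ 0 := by exact_mod_cast hm.ne'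
    apply mul_left_cancel₀ hm'
    have h1 : (m : K) * ∑ p ∈ Finset.HasAntidiagonal.antidiagonal m,
          PowerSeries.coeff p.1 (φ ^ k) * PowerSeries.coeff m (f ^ p.1) =
        PowerSeries.coeff m (PowerSeries.X * PowerSeries.derivative K (φ ^ k) * φ ^ m) := by
      rw [PowerSeries.coeff_mul, Finset.mul_sum]
      refine Finset.sum_congr rfl fun p hp => ?_
      have hp' := Finset.HasAntidiagonal.mem_antidiagonal.1 hp
      have h := ih m (by omega) p.1 (by omega)
      rw [mul_left_comm, h, show m - p.1 = p.2 by omega]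
      rcases hp1 : p.1 with _ | i
      · simp
      · rw [PowerSeries.coeff_succ_X_mul, PowerSeries.coeff_derivative]
        push_cast; ring
    -- Both sides equal `k (m + k) X φ^(m+k-1) φ'`.
    have h2 : ((m + k : ℕ) : PowerSeries K) *
          (PowerSeries.X * PowerSeries.derivative K (φ ^ k) * φ ^ m) =
        (k : PowerSeries K) * (PowerSeries.X * PowerSeries.derivative K (φ ^ (m + k))) := by
      obtain ⟨i, rfl⟩ : ∃ i, k = i + 1 := ⟨k - 1, by omega⟩
      rw [Derivation.leibniz_pow, Derivation.leibniz_pow]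
      simp only [smul_eq_mul, nsmul_eq_mul, Nat.add_sub_cancel, ← add_assoc]
      ring
    have h3 : PowerSeries.coeff m (PowerSeries.X * PowerSeries.derivative K (φ ^ (m + k))) =
        m * PowerSeries.coeff m (φ ^ (m + k)) := by
      obtain ⟨i, rfl⟩ : ∃ i, m = i + 1 := ⟨m - 1, by omega⟩
      rw [PowerSeries.coeff_succ_X_mul, PowerSeries.coeff_derivative]
      push_cast; ring
    have h4 := congrArg (PowerSeries.coeff m) h2
    rw [← nsmul_eq_mul, ← nsmul_eq_mul, map_nsmul, map_nsmul, h3, nsmul_eq_mul, nsmul_eq_mul] at h4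
    rw [mul_left_comm, h1, h4]
    ring

/-! ### Gaussian comparison for integrals of powers -/

theorem norm_pow_sub_pow_le {x y : ℂ} {r : ℝ} (hx : ‖x‖ ≤ r) (hy : ‖y‖ ≤ r) (n : ℕ) :
    ‖x ^ (n + 1) - y ^ (n + 1)‖ ≤ (n + 1) * ‖x - y‖ * r ^ n := by
  have hr : 0 ≤ r := (norm_nonneg x).trans hx
  rw [← (Commute.all x y).geom_sum₂_mul, norm_mul]
  have : ‖∑ i ∈ Finset.range (n + 1), x ^ i * y ^ (n + 1 - 1 - i)‖ ≤
      ∑ i ∈ Finset.range (n + 1), r ^ n := by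
    refine norm_sum_le_of_le _ fun i hi => ?_
    rw [norm_mul, norm_pow, norm_pow]
    have hi' : i ≤ n := by simpa [Nat.lt_succ_iff] using hi
    calc ‖x‖ ^ i * ‖y‖ ^ (n + 1 - 1 - i) ≤ r ^ i * r ^ (n - i) := by
          simp only [Nat.add_sub_cancel]; gcongr
      _ = r ^ n := by rw [← pow_add]; congr 1; omega
  rw [Finset.sum_const, Finset.card_range, nsmul_eq_mul] at this
  calc _ ≤ (((n + 1 : ℕ) : ℝ) * r ^ n) * ‖x - y‖ := by gcongr
    _ = _ := by push_cast; ring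

theorem integrable_abs_pow_three_mul_exp {b : ℝ} (hb : 0 < b) :
    Integrable fun x : ℝ => |x| ^ 3 * exp (-b * x ^ 2) := by
  have h := (integrable_rpow_mul_exp_neg_mul_sq hb (s := 3) (by norm_num)).norm
  refine h.congr (Filter.Eventually.of_forall fun x => ?_)
  simp only [norm_mul, norm_eq_abs, abs_exp]
  rw [show (3 : ℝ) = ((3 : ℕ) : ℝ) by norm_num, rpow_natCast, abs_pow]

/-- Scaling of the third absolute moment of a Gaussian. -/
theorem integral_abs_pow_three_mul_exp {b s : ℝ} (hs : 0 < s) :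
    ∫ x : ℝ, |x| ^ 3 * exp (-(b * s) * x ^ 2) =
      (∫ x : ℝ, |x| ^ 3 * exp (-b * x ^ 2)) / s ^ 2 := by
  have hq : 0 < √s := sqrt_pos.2 hs
  have h := Measure.integral_comp_mul_left (fun x : ℝ => |x| ^ 3 * exp (-b * x ^ 2)) (√s)
  have h2 : (fun x : ℝ => |√s * x| ^ 3 * exp (-b * (√s * x) ^ 2)) =
      fun x => √s ^ 3 * (|x| ^ 3 * exp (-(b * s) * x ^ 2)) := by
    funext x
    rw [abs_mul, abs_of_pos hq, mul_pow, mul_pow √s x 2, sq_sqrt hs.le]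
    ring_nf
  rw [h2, integral_const_mul, abs_of_pos (inv_pos.2 hq), smul_eq_mul] at h
  have h4 : √s ^ 4 = s ^ 2 := by rw [show (4 : ℕ) = 2 * 2 by rfl, pow_mul, sq_sqrt hs.le]
  rw [eq_div_iff (by positivity), ← h4]
  field_simp at h
  simp only [neg_mul]
  linarith

/-- Comparison of the integral of a power with the Gaussian integral, with constants that depend
only on the bounds in the hypotheses. -/
theorem exists_norm_integral_pow_sub_le {c T : ℝ} (hc : 0 < c) (hT : 0 ≤ T) :
    ∃ C : ℝ, 0 ≤ C ∧ ∀ (χ : ℝ → ℂ) (v : ℝ), Continuous χ → 2 * c ≤ v →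
      (∀ θ, |θ| ≤ π → ‖χ θ‖ ≤ exp (-c * θ ^ 2)) →
      (∀ θ, |θ| ≤ π → ‖χ θ - (exp (-(v / 2) * θ ^ 2) : ℝ)‖ ≤ T * |θ| ^ 3) →
      ∀ n : ℕ, 0 < n →
        ‖(∫ θ in (-π)..π, χ θ ^ n) - (√(2 * π / (n * v)) : ℝ)‖ ≤ C / n := by
  set J := ∫ x : ℝ, |x| ^ 3 * exp (-c * x ^ 2) with hJ
  have hJ0 : 0 ≤ J := integral_nonneg fun x => by positivity
  -- The difference of `n`-th powers leaves only `n - 1` decaying factors; the missing `exp(-cθ²)`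
  -- is restored at the cost of `exp(cπ²)`. The `+ 1` makes the same bound cover the Gaussian tail,
  -- where `|θ| ≥ 1`.
  set A := T * exp (c * π ^ 2) + 1 with hA
  have hA0 : 0 ≤ A := by positivity
  refine ⟨A * J, by positivity, fun χ v hχ hv h1 h2 n hn => ?_⟩
  obtain ⟨m, rfl⟩ : ∃ m, n = m + 1 := ⟨n - 1, by omega⟩
  have hn0 : (0 : ℝ) < ((m + 1 : ℕ) : ℝ) := by positivity
  have hv0 : 0 < v := by linarith
  set N : ℝ := ((m + 1 : ℕ) : ℝ) with hN
  have hN1 : 1 ≤ N := by rw [hN]; push_cast; linarith [(Nat.cast_nonneg m : (0 : ℝ) ≤ m)]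
  set g : ℝ → ℂ := fun θ => ((exp (-(N * v / 2) * θ ^ 2) : ℝ) : ℂ) with hg
  have hgi : Integrable g := (integrable_exp_neg_mul_sq (by positivity)).ofReal
  have hgint : ∫ θ, g θ = (√(2 * π / (N * v)) : ℝ) := by
    rw [hg]
    beta_reduce
    rw [integral_complex_ofReal, integral_gaussian]
    congr 2
    field_simp
  set I : Set ℝ := Ioc (-π) π with hI
  have hIπ : ∀ θ ∈ I, |θ| ≤ π := fun θ hθ => abs_le.2 ⟨hθ.1.le, hθ.2⟩
  -- With the Gaussian taken over the whole line, center and tail are controlled by one integrable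
  -- majorant, whose integral scales like `N / N²`.
  have hkey : (∫ θ in (-π)..π, χ θ ^ (m + 1)) - (√(2 * π / (N * v)) : ℝ) =
      ∫ θ, (I.indicator (fun θ => χ θ ^ (m + 1)) θ - g θ) := by
    rw [integral_sub _ hgi, hgint, integral_indicator measurableSet_Ioc,
      intervalIntegral.integral_of_le (by linarith [pi_pos])]
    rw [integrable_indicator_iff measurableSet_Ioc]
    exact ((hχ.pow _).intervalIntegrable (-π) π).1
  have hbound : ∀ θ, ‖I.indicator (fun θ => χ θ ^ (m + 1)) θ - g θ‖ ≤
      (A * N) * (|θ| ^ 3 * exp (-(c * N) * θ ^ 2)) := by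
    intro θ
    by_cases hθ : θ ∈ I
    · have hθπ := hIπ θ hθ
      rw [indicator_of_mem hθ]
      have hgp : g θ = ((exp (-(v / 2) * θ ^ 2) : ℝ) : ℂ) ^ (m + 1) := by
        rw [hg, ← Complex.ofReal_pow, ← exp_nat_mul, ← hN]
        beta_reduce
        congr 2
        ring
      have hgb : ‖((exp (-(v / 2) * θ ^ 2) : ℝ) : ℂ)‖ ≤ exp (-c * θ ^ 2) := by
        rw [Complex.norm_real, norm_eq_abs, abs_exp]
        apply exp_le_exp.2
        nlinarith [sq_nonneg θ]
      rw [hgp]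
      refine (norm_pow_sub_pow_le (h1 θ hθπ) hgb m).trans ?_
      have hm1 : (m : ℝ) + 1 = N := by rw [hN]; push_cast; rfl
      rw [hm1, ← exp_nat_mul]
      have he : exp (m * (-c * θ ^ 2)) ≤ exp (c * π ^ 2) * exp (-(c * N) * θ ^ 2) := by
        rw [← exp_add]
        apply exp_le_exp.2
        have : θ ^ 2 ≤ π ^ 2 := sq_le_sq' (by linarith [(abs_le.1 hθπ).1]) (abs_le.1 hθπ).2
        rw [← hm1]
        nlinarith
      calc N * ‖χ θ - (exp (-(v / 2) * θ ^ 2) : ℝ)‖ * exp (m * (-c * θ ^ 2))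
          ≤ N * (T * |θ| ^ 3) * (exp (c * π ^ 2) * exp (-(c * N) * θ ^ 2)) := by
            gcongr
            exact h2 θ hθπ
        _ = (T * exp (c * π ^ 2) * N) * (|θ| ^ 3 * exp (-(c * N) * θ ^ 2)) := by ring
        _ ≤ _ := by
            gcongr
            linarith
    · rw [indicator_of_notMem hθ, zero_sub, norm_neg, hg, Complex.norm_real, norm_eq_abs, abs_exp]
      have hθ1 : 1 ≤ |θ| := by
        by_contra! h
        apply hθ
        have := abs_lt.1 h
        have := pi_gt_three
        constructor <;> linarith
      calc exp (-(N * v / 2) * θ ^ 2) ≤ exp (-(c * N) * θ ^ 2) := by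
            apply exp_le_exp.2
            have : 0 ≤ N * θ ^ 2 := by positivity
            nlinarith
        _ ≤ (1 * 1) * (1 * exp (-(c * N) * θ ^ 2)) := by simp
        _ ≤ _ := by
            gcongr
            · rw [hA]; linarith [mul_nonneg hT (exp_pos (c * π ^ 2)).le]
            · exact one_le_pow₀ hθ1
  rw [hkey]
  refine (norm_integral_le_of_norm_le
    ((integrable_abs_pow_three_mul_exp (mul_pos hc hn0)).const_mul _)
    (Filter.Eventually.of_forall hbound)).trans (le_of_eq ?_)
  rw [integral_const_mul, integral_abs_pow_three_mul_exp hn0, ← hJ]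
  field_simp

/-! ### Powers of series and Cauchy's coefficient formula -/

/-- The sum of a power of a power series is the power of the sum. -/
theorem summable_norm_and_tsum_coeff_pow {v : PowerSeries ℂ} {z : ℂ}
    (h : Summable fun j => ‖PowerSeries.coeff j v * z ^ j‖) (n : ℕ) :
    (Summable fun j => ‖PowerSeries.coeff j (v ^ n) * z ^ j‖) ∧
      ∑' j, PowerSeries.coeff j (v ^ n) * z ^ j = (∑' j, PowerSeries.coeff j v * z ^ j) ^ n := by
  induction n with
  | zero =>
    have h0 : ∀ j, j ≠ 0 → PowerSeries.coeff j (v ^ 0) * z ^ j = 0 := fun j hj => by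
      simp [PowerSeries.coeff_one, hj]
    refine ⟨summable_of_ne_finset_zero (s := {0}) fun j hj => ?_, ?_⟩
    · rw [h0 j (by simpa using hj), norm_zero]
    · rw [tsum_eq_single 0 h0]; simp
  | succ n ih =>
    have e : ∀ j, PowerSeries.coeff j (v ^ (n + 1)) * z ^ j =
        ∑ p ∈ Finset.HasAntidiagonal.antidiagonal j,
          PowerSeries.coeff p.1 (v ^ n) * z ^ p.1 * (PowerSeries.coeff p.2 v * z ^ p.2) := by
      intro j
      rw [pow_succ, PowerSeries.coeff_mul, Finset.sum_mul]
      refine Finset.sum_congr rfl fun p hp => ?_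
      rw [← Finset.HasAntidiagonal.mem_antidiagonal.1 hp, pow_add]
      ring
    simp only [e]
    set a : ℕ → ℂ := fun j => PowerSeries.coeff j (v ^ n) * z ^ j
    set b : ℕ → ℂ := fun j => PowerSeries.coeff j v * z ^ j
    have h1 := summable_norm_sum_mul_antidiagonal_of_summable_norm (f := a) (g := b) ih.1 h
    have h2 := tsum_mul_tsum_eq_tsum_sum_antidiagonal_of_summable_norm (f := a) (g := b) ih.1 h
    exact ⟨h1, by rw [pow_succ, ← ih.2]; exact h2.symm⟩

theorem integral_exp_int_mul_I (k : ℤ) :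
    ∫ θ in (-π)..π, Complex.exp (k * θ * Complex.I) = if k = 0 then (2 * π : ℂ) else 0 := by
  split_ifs with hk
  · subst hk
    simp
    ring
  · have hc : (k : ℂ) * Complex.I ≠ 0 := by simp [hk, Complex.I_ne_zero]
    have h := integral_exp_mul_complex (a := -π) (b := π) hc
    have e : ∀ θ : ℝ, Complex.exp (k * θ * Complex.I) = Complex.exp (k * Complex.I * θ) :=
      fun θ => by ring_nf
    simp only [e, h]
    rw [div_eq_zero_iff, sub_eq_zero]
    left
    rw [Complex.exp_eq_exp_iff_exists_int]
    exact ⟨k, by push_cast; ring⟩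

/-- Cauchy's formula for the coefficients of an absolutely convergent power series. -/
theorem integral_tsum_mul_exp {v : PowerSeries ℂ} {y : ℝ}
    (h : Summable fun j => ‖PowerSeries.coeff j v * (y : ℂ) ^ j‖) (m : ℕ) :
    ∫ θ in (-π)..π, (∑' j, PowerSeries.coeff j v * (y * Complex.exp (θ * Complex.I)) ^ j) *
        Complex.exp (-(m * θ * Complex.I)) = 2 * π * (PowerSeries.coeff m v * y ^ m) := by
  set F : ℕ → ℝ → ℂ := fun j θ =>
    PowerSeries.coeff j v * y ^ j * Complex.exp (((j : ℤ) - (m : ℤ) : ℤ) * θ * Complex.I) with hF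
  have hFn : ∀ j θ, ‖F j θ‖ = ‖PowerSeries.coeff j v * (y : ℂ) ^ j‖ := fun j θ => by
    have : (((j : ℤ) - (m : ℤ) : ℤ) : ℂ) * θ = (((((j : ℤ) - (m : ℤ) : ℤ) : ℝ) * θ : ℝ) : ℂ) := by
      push_cast; ring
    rw [hF]
    beta_reduce
    rw [norm_mul _ (Complex.exp _), this, Complex.norm_exp_ofReal_mul_I, mul_one]
  have hFe : ∀ (j : ℕ) (θ : ℝ), PowerSeries.coeff j v * (y * Complex.exp (θ * Complex.I)) ^ j *
      Complex.exp (-(m * θ * Complex.I)) = F j θ := fun j θ => by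
    rw [hF]
    beta_reduce
    rw [mul_pow, ← Complex.exp_nat_mul, ← mul_assoc, mul_assoc _ (Complex.exp _),
      ← Complex.exp_add]
    congr 2
    push_cast
    ring
  have hsum : ∀ θ : ℝ, HasSum (fun j => F j θ)
      ((∑' j, PowerSeries.coeff j v * (y * Complex.exp (θ * Complex.I)) ^ j) *
        Complex.exp (-(m * θ * Complex.I))) := fun θ => by
    rw [← tsum_mul_right]
    simp only [hFe]
    refine (Summable.of_norm ?_).hasSum
    simpa only [hFn] using h
  have hint := intervalIntegral.hasSum_integral_of_dominated_convergence (μ := volume)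
    (a := -π) (b := π) (F := F)
    (fun j _ => ‖PowerSeries.coeff j v * (y : ℂ) ^ j‖)
    (fun j => Continuous.aestronglyMeasurable (by rw [hF]; fun_prop))
    (fun j => Filter.Eventually.of_forall fun θ _ => (hFn j θ).le)
    (Filter.Eventually.of_forall fun θ _ => h)
    (by simp)
    (Filter.Eventually.of_forall fun θ _ => hsum θ)
  have hone : ∀ j, ∫ θ in (-π)..π, F j θ =
      if j = m then 2 * π * (PowerSeries.coeff m v * y ^ m) else 0 := fun j => by
    rw [hF]
    beta_reduce
    rw [intervalIntegral.integral_const_mul, integral_exp_int_mul_I]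
    by_cases hj : j = m
    · subst hj; simp; ring
    · have : ¬ ((j : ℤ) - m = 0) := by omega
      simp [hj, this]
  simp only [hone] at hint
  exact hint.unique (hasSum_ite_eq m _)

/-! ### Moments and termwise differentiation -/

theorem hasSum_of_eq {E : Type*} [AddCommMonoid E] [TopologicalSpace E] {f g : ℕ → E} {a b : E}
    (h : HasSum f a) (hfg : ∀ j, g j = f j) (hab : b = a) : HasSum g b := by
  rw [funext hfg, hab]; exact h

/-- All the moments of the coefficients of `v`, weighted by the powers of `ρ`, converge. -/
def MomentSummable (v : PowerSeries ℝ) (ρ : ℝ) : Prop :=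
  ∀ k : ℕ, Summable fun j : ℕ => (j : ℝ) ^ k * (|PowerSeries.coeff j v| * ρ ^ j)

theorem exists_gt_of_ofReal_lt_radius {v : PowerSeries ℝ} {y : ℝ}
    (h : ENNReal.ofReal y < radius v) : ∃ ρ, y < ρ ∧ 0 < ρ ∧ ENNReal.ofReal ρ < radius v := by
  obtain ⟨r, hr1, hr2⟩ := ENNReal.lt_iff_exists_nnreal_btwn.1 h
  have hr : y < r := by
    by_contra! h'
    exact absurd hr1 (not_lt.2 (by
      rw [← ENNReal.ofReal_coe_nnreal]; exact ENNReal.ofReal_le_ofReal h'))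
  have hr0 : (0 : ℝ) < r := by
    rcases lt_or_ge 0 y with hy | hy
    · exact hy.trans hr
    · rw [ENNReal.ofReal_of_nonpos hy] at hr1
      exact_mod_cast hr1
  exact ⟨r, hr, hr0, by simpa using hr2⟩

/-- There is room for some `ρ > y` below the radius, and the geometric factor `(y/ρ)^j` absorbs
every power of `j`. -/
theorem momentSummable_of_lt_radius {v : PowerSeries ℝ} {y : ℝ} (hy : 0 ≤ y)
    (h : ENNReal.ofReal y < radius v) : MomentSummable v y := by
  obtain ⟨ρ, hyρ, hρ, hρr⟩ := exists_gt_of_ofReal_lt_radius h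
  obtain ⟨C, -, hC⟩ := FormalMultilinearSeries.norm_mul_pow_le_of_lt_radius _
    (r := ρ.toNNReal) (show ((ρ.toNNReal : NNReal) : ENNReal) < _ from hρr)
  intro k
  have hq : ‖y / ρ‖ < 1 := by
    rw [Real.norm_of_nonneg (by positivity), div_lt_one hρ]; exact hyρ
  refine ((summable_pow_mul_geometric_of_norm_lt_one k hq).mul_left C).of_nonneg_of_le
    (fun j => by positivity) fun j => ?_
  have hj := hC j
  rw [FormalMultilinearSeries.ofScalars_norm, Real.coe_toNNReal _ hρ.le, Real.norm_eq_abs] at hj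
  calc (j : ℝ) ^ k * (|PowerSeries.coeff j v| * y ^ j)
      = (j : ℝ) ^ k * ((|PowerSeries.coeff j v| * ρ ^ j) * (y / ρ) ^ j) := by
        rw [div_pow]; field_simp
    _ ≤ (j : ℝ) ^ k * (C * (y / ρ) ^ j) := by gcongr
    _ = _ := by ring

theorem MomentSummable.summable_abs {v : PowerSeries ℝ} {ρ : ℝ} (h : MomentSummable v ρ) :
    Summable fun j => |PowerSeries.coeff j v| * ρ ^ j := by simpa using h 0

/-- Differentiation costs one factor `j`, that is, one moment; this is why all moments are required
at once. -/
theorem MomentSummable.derivative {v : PowerSeries ℝ} {ρ : ℝ} (hρ : 0 < ρ)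
    (h : MomentSummable v ρ) : MomentSummable (PowerSeries.derivative ℝ v) ρ := by
  intro k
  have h1 := ((summable_nat_add_iff 1).2 (h (k + 1))).mul_left ρ⁻¹
  refine h1.of_nonneg_of_le (fun j => by positivity) fun j => ?_
  rw [PowerSeries.coeff_derivative, abs_mul,
    abs_of_nonneg (by positivity : (0 : ℝ) ≤ (j : ℝ) + 1)]
  push_cast
  have e : ρ⁻¹ * (((j : ℝ) + 1) ^ (k + 1) * (|PowerSeries.coeff (j + 1) v| * ρ ^ (j + 1))) =
      ((j : ℝ) + 1) ^ k * (|PowerSeries.coeff (j + 1) v| * ((j : ℝ) + 1) * ρ ^ j) := by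
    rw [pow_succ ρ, pow_succ _ k]; field_simp
  rw [e]
  gcongr
  linarith

theorem MomentSummable.mono {v : PowerSeries ℝ} {x ρ : ℝ} (hx : 0 ≤ x) (hxρ : x ≤ ρ)
    (h : MomentSummable v ρ) : MomentSummable v x := fun k =>
  (h k).of_nonneg_of_le (fun j => by positivity) fun j => by gcongr

theorem hasDerivAt_eval {v : PowerSeries ℝ} {ρ y : ℝ} (h : MomentSummable v ρ) (hy : |y| < ρ) :
    HasDerivAt (eval v) (eval (PowerSeries.derivative ℝ v) y) y := by
  have hρ : 0 < ρ := (abs_nonneg y).trans_lt hy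
  set g : ℕ → ℝ → ℝ := fun j x => PowerSeries.coeff j v * x ^ j
  set g' : ℕ → ℝ → ℝ := fun j x => PowerSeries.coeff j v * (j * x ^ (j - 1))
  set u : ℕ → ℝ := fun j => (j : ℝ) ^ 1 * (|PowerSeries.coeff j v| * ρ ^ j) * ρ⁻¹
  have hu : Summable u := (h 1).mul_right _
  have hbd : ∀ j x, x ∈ Ioo (-ρ) ρ → ‖g' j x‖ ≤ u j := fun j x hx => by
    have hx' : |x| ≤ ρ := (abs_lt.2 hx).le
    rcases j with _ | j
    · simp [g', u]
    · simp only [g', u, norm_mul, Real.norm_eq_abs, Nat.add_sub_cancel, abs_pow, Nat.abs_cast]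
      calc |PowerSeries.coeff (j + 1) v| * (((j + 1 : ℕ) : ℝ) * |x| ^ j)
          ≤ |PowerSeries.coeff (j + 1) v| * (((j + 1 : ℕ) : ℝ) * ρ ^ j) := by gcongr
        _ = _ := by rw [pow_succ ρ]; field_simp
  have hyI : y ∈ Ioo (-ρ) ρ := abs_lt.1 hy
  have h0 : Summable fun j => g j 0 :=
    summable_of_ne_finset_zero (s := {0}) fun j hj => by
      simp only [Finset.mem_singleton] at hj
      simp [g, hj]
  have hd := hasDerivAt_tsum_of_isPreconnected hu isOpen_Ioo isPreconnected_Ioo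
    (g := g) (g' := g') (fun j x _ => (hasDerivAt_pow j x).const_mul _) hbd
    (y₀ := 0) (by constructor <;> linarith) h0 hyI
  have hs : Summable fun j => g' j y := Summable.of_norm_bounded hu fun j => hbd j y hyI
  have e : ∑' j, g' j y = eval (PowerSeries.derivative ℝ v) y := by
    rw [hs.tsum_eq_zero_add, eval]
    simp only [g', PowerSeries.coeff_derivative, Nat.add_sub_cancel]
    simp [mul_assoc]
  rw [e] at hd
  exact hd

theorem deriv_eval_eventuallyEq {v : PowerSeries ℝ} {ρ y : ℝ} (h : MomentSummable v ρ)
    (hy : |y| < ρ) : deriv (eval v) =ᶠ[nhds y] eval (PowerSeries.derivative ℝ v) := by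
  filter_upwards [continuous_abs.continuousAt.eventually_lt_const hy] with x hx
  exact (hasDerivAt_eval h hx).deriv

/-- The Euler operator acts on the terms of a power series by multiplication by the exponent. -/
theorem hasSum_mul_eval_derivative {v : PowerSeries ℝ} {y : ℝ} (h : MomentSummable v y) :
    HasSum (fun j : ℕ => (j : ℝ) * (PowerSeries.coeff j v * y ^ j))
      (y * eval (PowerSeries.derivative ℝ v) y) := by
  have hs : Summable (fun j : ℕ => (j : ℝ) * (PowerSeries.coeff j v * y ^ j)) := by
    refine ((h 1).norm).of_norm_bounded fun j => le_of_eq ?_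
    simp
  convert hs.hasSum using 1
  rw [hs.tsum_eq_zero_add, eval, ← tsum_mul_left]
  simp only [PowerSeries.coeff_derivative]
  simp only [CharP.cast_eq_zero, zero_mul, zero_add]
  refine tsum_congr fun j => ?_
  push_cast; ring

/-! ### Mean and variance of the tilted distribution, and solvability of the mean equation -/

section Moments

variable {φ : PowerSeries ℝ} {y : ℝ}

theorem hasSum_eval (h : MomentSummable φ y) :
    HasSum (fun j => PowerSeries.coeff j φ * y ^ j) (eval φ y) := by
  refine Summable.hasSum ((h.summable_abs.norm).of_norm_bounded fun j => le_of_eq ?_)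
  simp

theorem coeff_zero_le_eval (hnonneg : ∀ j : ℕ, 0 ≤ PowerSeries.coeff j φ) (hy : 0 ≤ y)
    (h : MomentSummable φ y) : PowerSeries.coeff 0 φ ≤ eval φ y := by
  have := le_hasSum (hasSum_eval h) 0 fun j _ => mul_nonneg (hnonneg j) (pow_nonneg hy j)
  simpa using this

theorem eval_pos (hnonneg : ∀ j : ℕ, 0 ≤ PowerSeries.coeff j φ)
    (hzero : PowerSeries.coeff 0 φ ≠ 0) (hy : 0 ≤ y) (h : MomentSummable φ y) :
    0 < eval φ y :=
  ((hnonneg 0).lt_of_ne' hzero).trans_le (coeff_zero_le_eval hnonneg hy h)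

theorem mu_eq {ρ : ℝ} (h : MomentSummable φ ρ) (hy : |y| < ρ) :
    mu φ y = y * eval (PowerSeries.derivative ℝ φ) y / eval φ y := by
  rw [mu, (hasDerivAt_eval h hy).deriv]

theorem sigmaSq_eq {ρ : ℝ} (h : MomentSummable φ ρ) (hy : |y| < ρ) :
    sigmaSq φ y =
      y ^ 2 * eval (PowerSeries.derivative ℝ (PowerSeries.derivative ℝ φ)) y / eval φ y +
        mu φ y - mu φ y ^ 2 := by
  have hρ : 0 < ρ := (abs_nonneg y).trans_lt hy
  rw [sigmaSq, (deriv_eval_eventuallyEq h hy).deriv_eq,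
    (hasDerivAt_eval (h.derivative hρ) hy).deriv]

/-- The identity `y μ'(y) = σ²(y)`: positivity of a variance becomes monotonicity of the mean. -/
theorem hasDerivAt_mu {ρ : ℝ} (h : MomentSummable φ ρ) (hy0 : 0 < y) (hy : y < ρ)
    (hev : eval φ y ≠ 0) : HasDerivAt (mu φ) (sigmaSq φ y / y) y := by
  have hy' : |y| < ρ := by rwa [abs_of_pos hy0]
  have hρ : 0 < ρ := hy0.trans hy
  have hev' : mu φ =ᶠ[nhds y]
      fun x => x * eval (PowerSeries.derivative ℝ φ) x / eval φ x := by
    filter_upwards [continuous_abs.continuousAt.eventually_lt_const hy'] with x hx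
    exact mu_eq h hx
  have hd := (((hasDerivAt_id y).mul (hasDerivAt_eval (h.derivative hρ) hy')).div
    (hasDerivAt_eval h hy') hev).congr_of_eventuallyEq hev'
  refine hd.congr_deriv ?_
  rw [sigmaSq_eq h hy', mu_eq h hy']
  simp only [id, Pi.mul_apply]
  field_simp
  ring

section Domain

variable (hy : 0 < y) (hr : ENNReal.ofReal y < radius φ)
include hy hr

omit hy in
theorem exists_momentSummable_gt : ∃ ρ, y < ρ ∧ MomentSummable φ ρ := by
  obtain ⟨ρ, h1, h2, h3⟩ := exists_gt_of_ofReal_lt_radius hr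
  exact ⟨ρ, h1, momentSummable_of_lt_radius h2.le h3⟩

theorem hasSum_mul_mu (hev : eval φ y ≠ 0) :
    HasSum (fun j : ℕ => (j : ℝ) * (PowerSeries.coeff j φ * y ^ j)) (mu φ y * eval φ y) := by
  obtain ⟨ρ, hρ, h⟩ := exists_momentSummable_gt hr
  rw [mu_eq h (by rwa [abs_of_pos hy]), div_mul_cancel₀ _ hev]
  exact hasSum_mul_eval_derivative (h.mono hy.le hρ.le)

theorem hasSum_sq_mul_sigmaSq (hev : eval φ y ≠ 0) :
    HasSum (fun j : ℕ => ((j : ℝ) - mu φ y) ^ 2 * (PowerSeries.coeff j φ * y ^ j))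
      (sigmaSq φ y * eval φ y) := by
  obtain ⟨ρ, hρ, h⟩ := exists_momentSummable_gt hr
  have hy' : |y| < ρ := by rwa [abs_of_pos hy]
  have h2 := (hasSum_mul_eval_derivative ((h.derivative (hy.trans hρ)).mono hy.le hρ.le)).mul_left y
  -- The Euler operator applied to `φ'`, with the index shifted by one, produces the factorial
  -- moment `j (j - 1)`.
  have h3 : HasSum (fun j : ℕ => (j : ℝ) * ((j : ℝ) - 1) * (PowerSeries.coeff j φ * y ^ j))
      (y ^ 2 * eval (PowerSeries.derivative ℝ (PowerSeries.derivative ℝ φ)) y) := by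
    refine (hasSum_nat_add_iff' 1).1 ?_
    refine hasSum_of_eq h2 (fun j => ?_) (by simp; ring)
    rw [PowerSeries.coeff_derivative]
    push_cast
    ring
  -- `(j - μ)² = j(j - 1) + (1 - 2μ) j + μ²`.
  have h4 := (h3.add ((hasSum_mul_mu hy hr hev).mul_left (1 - 2 * mu φ y))).add
    ((hasSum_eval (h.mono hy.le hρ.le)).mul_left (mu φ y ^ 2))
  refine hasSum_of_eq h4 (fun j => by ring) ?_
  rw [sigmaSq_eq h hy']
  field_simp
  ring

variable (hnonneg : ∀ j : ℕ, 0 ≤ PowerSeries.coeff j φ) (hzero : PowerSeries.coeff 0 φ ≠ 0)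
include hnonneg hzero

theorem eval_pos_of_lt_radius : 0 < eval φ y :=
  eval_pos hnonneg hzero hy.le (momentSummable_of_lt_radius hy.le hr)

theorem mu_pos (hdeg : ∃ j : ℕ, 2 ≤ j ∧ PowerSeries.coeff j φ ≠ 0) : 0 < mu φ y := by
  have hev := eval_pos_of_lt_radius hy hr hnonneg hzero
  obtain ⟨j, hj, hφj⟩ := hdeg
  have h := le_hasSum (hasSum_mul_mu hy hr hev.ne') j fun i _ =>
    mul_nonneg (Nat.cast_nonneg i) (mul_nonneg (hnonneg i) (pow_nonneg hy.le i))
  have hj0 : (0 : ℝ) < j := by exact_mod_cast (by omega : 0 < j)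
  have hc : 0 < PowerSeries.coeff j φ := (hnonneg j).lt_of_ne' hφj
  have h' : 0 < (j : ℝ) * (PowerSeries.coeff j φ * y ^ j) := by positivity
  exact pos_of_mul_pos_left (h'.trans_le h) hev.le

/-- The atom at zero bounds the variance from below. -/
theorem coeff_zero_mul_mu_sq_le :
    PowerSeries.coeff 0 φ * mu φ y ^ 2 ≤ sigmaSq φ y * eval φ y := by
  have h := le_hasSum (hasSum_sq_mul_sigmaSq hy hr
    (eval_pos_of_lt_radius hy hr hnonneg hzero).ne') 0 fun i _ =>
    mul_nonneg (sq_nonneg _) (mul_nonneg (hnonneg i) (pow_nonneg hy.le i))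
  simpa [mul_comm] using h

theorem sigmaSq_pos (hdeg : ∃ j : ℕ, 2 ≤ j ∧ PowerSeries.coeff j φ ≠ 0) : 0 < sigmaSq φ y := by
  have hm := mu_pos hy hr hnonneg hzero hdeg
  have h0 : 0 < PowerSeries.coeff 0 φ := (hnonneg 0).lt_of_ne' hzero
  have h' : 0 < PowerSeries.coeff 0 φ * mu φ y ^ 2 := by positivity
  exact pos_of_mul_pos_left (h'.trans_le (coeff_zero_mul_mu_sq_le hy hr hnonneg hzero))
    (eval_pos_of_lt_radius hy hr hnonneg hzero).le

end Domain

variable (hnonneg : ∀ j : ℕ, 0 ≤ PowerSeries.coeff j φ) (hzero : PowerSeries.coeff 0 φ ≠ 0)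
include hnonneg hzero

theorem strictMonoOn_mu (hdeg : ∃ j : ℕ, 2 ≤ j ∧ PowerSeries.coeff j φ ≠ 0) :
    StrictMonoOn (mu φ) {y : ℝ | 0 < y ∧ ENNReal.ofReal y < radius φ} := by
  have hoc : OrdConnected {y : ℝ | 0 < y ∧ ENNReal.ofReal y < radius φ} :=
    ⟨fun a ha b hb x hx => ⟨ha.1.trans_le hx.1, (ENNReal.ofReal_le_ofReal hx.2).trans_lt hb.2⟩⟩
  have hd : ∀ x ∈ {y : ℝ | 0 < y ∧ ENNReal.ofReal y < radius φ},
      HasDerivAt (mu φ) (sigmaSq φ x / x) x := fun x hx => by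
    obtain ⟨ρ, hρ, h⟩ := exists_momentSummable_gt hx.2
    exact hasDerivAt_mu h hx.1 hρ (eval_pos_of_lt_radius hx.1 hx.2 hnonneg hzero).ne'
  refine strictMonoOn_of_deriv_pos hoc.convex
    (fun x hx => (hd x hx).continuousAt.continuousWithinAt) fun x hx => ?_
  have hx' := interior_subset hx
  rw [(hd x hx').deriv]
  exact div_pos (sigmaSq_pos hx'.1 hx'.2 hnonneg hzero hdeg) hx'.1

theorem existsUnique_isPositiveSolution
    (hdeg : ∃ j : ℕ, 2 ≤ j ∧ PowerSeries.coeff j φ ≠ 0) {t : ℝ} (ht : t ∈ admissible φ) :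
    ∃! y : ℝ, IsPositiveSolution φ t y := by
  obtain ⟨⟨-, ht1⟩, htB⟩ := ht
  simp only [orderAtInfinity, lt_iSup_iff] at htB
  obtain ⟨b, ⟨hb0, hbr⟩, hb⟩ := htB
  have hb' : 1 - t < mu φ b := by exact_mod_cast hb
  obtain ⟨ρ, hρ, h⟩ := exists_momentSummable_gt hbr
  -- This quotient agrees with `mu φ` on `(0, b]`, is continuous up to `0`, and vanishes there, so
  -- the intermediate value theorem applies on `[0, b]`.
  set m : ℝ → ℝ := fun x => x * eval (PowerSeries.derivative ℝ φ) x / eval φ x with hm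
  have habs : ∀ x ∈ Icc 0 b, |x| < ρ := fun x hx => by
    rw [abs_of_nonneg hx.1]; exact hx.2.trans_lt hρ
  have hcont : ContinuousOn m (Icc 0 b) := fun x hx => by
    refine ContinuousAt.continuousWithinAt ?_
    exact (continuousAt_id.mul
      (hasDerivAt_eval (h.derivative (hb0.trans hρ)) (habs x hx)).continuousAt).div
      (hasDerivAt_eval h (habs x hx)).continuousAt
      (eval_pos hnonneg hzero hx.1 (h.mono hx.1 (hx.2.trans hρ.le))).ne'
  have hmb : m b = mu φ b := (mu_eq h (habs b ⟨hb0.le, le_rfl⟩)).symm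
  have hm0 : m 0 = 0 := by simp [hm]
  obtain ⟨y, hy, hyt⟩ := intermediate_value_Ioo hb0.le hcont
    (show 1 - t ∈ Ioo (m 0) (m b) by rw [hm0, hmb]; exact ⟨by linarith, hb'⟩)
  have hyr : ENNReal.ofReal y < radius φ := (ENNReal.ofReal_le_ofReal hy.2.le).trans_lt hbr
  refine ⟨y, ⟨hy.1, hyr, by rw [mu_eq h (habs y ⟨hy.1.le, hy.2.le⟩)]; exact hyt⟩, fun z hz => ?_⟩
  refine (strictMonoOn_mu hnonneg hzero hdeg).injOn ⟨hz.1, hz.2.1⟩ ⟨hy.1, hyr⟩ ?_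
  rw [hz.2.2, mu_eq h (habs y ⟨hy.1.le, hy.2.le⟩)]
  exact hyt.symm

/-- An entire series with a term of degree at least two has order at least two at infinity. -/
theorem two_le_orderAtInfinity (hdeg : ∃ j : ℕ, 2 ≤ j ∧ PowerSeries.coeff j φ ≠ 0)
    (hr : radius φ = ⊤) : 2 ≤ orderAtInfinity φ := by
  refine le_of_forall_lt fun c hc => ?_
  obtain ⟨r, hcr, hr2⟩ := EReal.lt_iff_exists_real_btwn.1 hc
  have hr2' : r < 2 := EReal.coe_lt_coe_iff.1 hr2
  refine hcr.trans ?_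
  simp only [orderAtInfinity, lt_iSup_iff]
  obtain ⟨j, hj, hφj⟩ := hdeg
  have hcj : 0 < PowerSeries.coeff j φ := (hnonneg j).lt_of_ne' hφj
  -- Only `i = 0, 1` contribute negatively to `∑ (i - 2) φᵢ yⁱ = (μ - 2) φ(y)`, at worst `-s y` for
  -- `y ≥ 1`. The choice of `y` below gives `(2 - r) φⱼ y > s`, hence `(2 - r) φ(y) > s y` and `μ >
  -- r`.
  set s := 2 * PowerSeries.coeff 0 φ + PowerSeries.coeff 1 φ with hs
  have hs0 : 0 ≤ s := by linarith [hnonneg 0, hnonneg 1]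
  have hd : 0 < PowerSeries.coeff j φ * (2 - r) := mul_pos hcj (by linarith)
  set y := 1 + s / (PowerSeries.coeff j φ * (2 - r)) with hy
  have hy1 : 1 ≤ y := by rw [hy]; linarith [div_nonneg hs0 hd.le]
  have hy0 : 0 < y := by linarith
  have hyr : ENNReal.ofReal y < radius φ := by rw [hr]; exact ENNReal.ofReal_lt_top
  have hMS := momentSummable_of_lt_radius hy0.le hyr
  have hev := eval_pos hnonneg hzero hy0.le hMS
  refine ⟨y, ⟨hy0, hyr⟩, ?_⟩
  have hsum := (hasSum_mul_mu hy0 hyr hev.ne').sub ((hasSum_eval hMS).mul_left 2)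
  have h1 := sum_le_hasSum ({0, 1} : Finset ℕ) (fun i hi => by
    have hi2 : (2 : ℝ) ≤ i := by
      have : 2 ≤ i := by
        simp only [Finset.mem_insert, Finset.mem_singleton] at hi; omega
      exact_mod_cast this
    have hw := mul_nonneg (hnonneg i) (pow_nonneg hy0.le i)
    nlinarith) hsum
  rw [Finset.sum_pair (by norm_num)] at h1
  simp only [Nat.cast_zero, zero_mul, pow_zero, mul_one, Nat.cast_one, pow_one, one_mul] at h1
  have h2 : PowerSeries.coeff j φ * y ^ 2 ≤ eval φ y :=
    calc PowerSeries.coeff j φ * y ^ 2 ≤ PowerSeries.coeff j φ * y ^ j := by gcongr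
      _ ≤ eval φ y := le_hasSum (hasSum_eval hMS) j fun i _ =>
          mul_nonneg (hnonneg i) (pow_nonneg hy0.le i)
  have h3 : s < (2 - r) * (PowerSeries.coeff j φ * y) := by
    have : (2 - r) * (PowerSeries.coeff j φ * y) = PowerSeries.coeff j φ * (2 - r) + s := by
      have h2r : 2 - r ≠ 0 := by linarith
      rw [hy]; field_simp
    rw [this]; linarith
  have h4 : s * y < (2 - r) * eval φ y :=
    calc s * y < (2 - r) * (PowerSeries.coeff j φ * y) * y := by gcongr
      _ = (2 - r) * (PowerSeries.coeff j φ * y ^ 2) := by ring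
      _ ≤ _ := by
        have : 0 ≤ 2 - r := by linarith
        gcongr
  have h5 : 2 * PowerSeries.coeff 0 φ + PowerSeries.coeff 1 φ * y ≤ s * y := by
    rw [hs]; nlinarith [hnonneg 0]
  have h6 : r * eval φ y < mu φ y * eval φ y := by linarith
  exact_mod_cast lt_of_mul_lt_mul_right h6 hev.le

end Moments

theorem admissible_eq_Ioo {φ : PowerSeries ℝ} (h : 1 ≤ orderAtInfinity φ) :
    admissible φ = Ioo (0 : ℝ) 1 := by
  refine subset_antisymm (fun t ht => ht.1) fun t ht => ⟨ht, lt_of_lt_of_le ?_ h⟩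
  exact_mod_cast (by linarith [ht.1] : 1 - t < 1)

/-! ### Characteristic functions of distributions on `ℕ` -/

/-- The characteristic function of the distribution `p` on `ℕ`, centered at `m`. -/
noncomputable def centeredCharFn (p : ℕ → ℝ) (m θ : ℝ) : ℂ :=
  ∑' j : ℕ, (p j : ℂ) * Complex.exp ((((j : ℝ) - m) * θ : ℝ) * Complex.I)

theorem norm_exp_mul_I_sub_quadratic_le (x : ℝ) :
    ‖Complex.exp (x * Complex.I) - (1 + x * Complex.I - x ^ 2 / 2)‖ ≤ 4 * |x| ^ 3 := by
  have hn : ‖(x : ℂ) * Complex.I‖ = |x| := by simp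
  rcases le_or_gt |x| 1 with hx | hx
  · have h := Complex.exp_bound (x := x * Complex.I) (by rwa [hn]) (n := 3) (by norm_num)
    have e : ∑ m ∈ Finset.range 3, ((x : ℂ) * Complex.I) ^ m / (m.factorial : ℂ) =
        1 + x * Complex.I - x ^ 2 / 2 := by
      simp [Finset.sum_range_succ, mul_pow]
      ring
    rw [e, hn] at h
    refine h.trans ?_
    have : 0 ≤ |x| ^ 3 := by positivity
    norm_num [Nat.factorial]
    linarith
  · have h1 : ‖Complex.exp (x * Complex.I)‖ = 1 := Complex.norm_exp_ofReal_mul_I x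
    have h2 : ‖1 + (x : ℂ) * Complex.I - x ^ 2 / 2‖ ≤ 1 + |x| + |x| ^ 2 / 2 := by
      refine (norm_sub_le _ _).trans (add_le_add ((norm_add_le _ _).trans ?_) ?_)
      · rw [hn, norm_one]
      · simp
    refine (norm_sub_le _ _).trans ?_
    rw [h1]
    have h3 : |x| ≤ |x| ^ 3 := le_self_pow₀ hx.le (by norm_num)
    have h4 : |x| ^ 2 ≤ |x| ^ 3 := pow_le_pow_right₀ hx.le (by norm_num)
    linarith

theorem abs_exp_neg_sub_le {u : ℝ} (hu : 0 ≤ u) : |exp (-u) - (1 - u)| ≤ u ^ 2 := by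
  have h1 := add_one_le_exp (-u)
  rw [abs_of_nonneg (by linarith)]
  rcases le_or_gt u 1 with h | h
  · have := Real.norm_exp_sub_one_sub_id_le (x := -u) (by simpa [abs_of_nonneg hu] using h)
    simp only [norm_eq_abs, abs_neg, sq_abs] at this
    linarith [le_abs_self (exp (-u) - 1 - -u)]
  · have : exp (-u) ≤ 1 := exp_le_one_iff.2 (by linarith)
    nlinarith

section Distribution

variable {p : ℕ → ℝ} (hp : ∀ j, 0 ≤ p j) (h1 : HasSum p 1) (m : ℝ)
include hp

theorem norm_centeredCharFn_term (θ : ℝ) (j : ℕ) :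
    ‖(p j : ℂ) * Complex.exp ((((j : ℝ) - m) * θ : ℝ) * Complex.I)‖ = p j := by
  rw [norm_mul, Complex.norm_exp_ofReal_mul_I, mul_one, Complex.norm_real, norm_of_nonneg (hp j)]

include h1

theorem hasSum_centeredCharFn (θ : ℝ) :
    HasSum (fun j : ℕ => (p j : ℂ) * Complex.exp ((((j : ℝ) - m) * θ : ℝ) * Complex.I))
      (centeredCharFn p m θ) :=
  (Summable.of_norm (by simpa only [norm_centeredCharFn_term hp] using h1.summable)).hasSum

theorem continuous_centeredCharFn : Continuous (centeredCharFn p m) :=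
  continuous_tsum (fun j => by fun_prop) h1.summable
    fun j θ => (norm_centeredCharFn_term hp m θ j).le

/-- Two atoms, at `0` and at `j`, bound the characteristic function away from one. -/
theorem norm_centeredCharFn_le (j : ℕ) (θ : ℝ) :
    ‖centeredCharFn p m θ‖ ≤ 1 - 2 * (p 0 * p j) * sin (j * θ / 2) ^ 2 := by
  set t : ℕ → ℂ := fun j => (p j : ℂ) * Complex.exp ((((j : ℝ) - m) * θ : ℝ) * Complex.I) with ht
  have htn : ∀ i, ‖t i‖ = p i := norm_centeredCharFn_term hp m θ
  have hts : HasSum t (centeredCharFn p m θ) := hasSum_centeredCharFn hp h1 m θ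
  have hns : Summable fun i => ‖t i‖ := by simpa only [htn] using h1.summable
  rcases eq_or_ne j 0 with rfl | hj
  · simp only [Nat.cast_zero, zero_mul, zero_div, sin_zero]
    have := norm_tsum_le_tsum_norm hns
    simp only [htn, h1.tsum_eq] at this
    have h : ‖centeredCharFn p m θ‖ ≤ 1 := by rw [← hts.tsum_eq]; exact this
    simpa using h
  set s : Finset ℕ := {0, j}
  have hs1 := hts.summable.sum_add_tsum_compl (s := s)
  have hs2 := h1.summable.sum_add_tsum_compl (s := s)
  rw [hts.tsum_eq, Finset.sum_pair hj.symm] at hs1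
  rw [h1.tsum_eq, Finset.sum_pair hj.symm] at hs2
  have hrest : ‖∑' i : ↑((s : Set ℕ)ᶜ), t i‖ ≤ ∑' i : ↑((s : Set ℕ)ᶜ), p i := by
    refine (norm_tsum_le_tsum_norm (hns.subtype _)).trans (le_of_eq ?_)
    simp only [htn]
  have hrest0 : 0 ≤ ∑' i : ↑((s : Set ℕ)ᶜ), p i := tsum_nonneg fun i => hp i
  have hS : p 0 + p j ≤ 1 := by linarith
  -- With `q = sin²(jθ/2)` and `S = p₀ + pⱼ`, the squared norm is `S² - 4 p₀ pⱼ q`. This is at most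
  -- `(S - 2 p₀ pⱼ q)²` because `S ≤ 1`.
  have hpair : ‖t 0 + t j‖ ≤ p 0 + p j - 2 * (p 0 * p j) * sin (j * θ / 2) ^ 2 := by
    have e : t 0 + t j = Complex.exp (((-m * θ : ℝ) : ℂ) * Complex.I) *
        ((p 0 + p j * cos (j * θ) : ℝ) + (p j * sin (j * θ) : ℝ) * Complex.I) := by
      simp only [ht]
      have e1 : Complex.exp ((((j : ℝ) - m) * θ : ℝ) * Complex.I) =
          Complex.exp (((-m * θ : ℝ) : ℂ) * Complex.I) *
            (cos (j * θ) + sin (j * θ) * Complex.I) := by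
        rw [Complex.ofReal_cos, Complex.ofReal_sin, ← Complex.exp_mul_I, ← Complex.exp_add]
        congr 1
        push_cast
        ring
      rw [e1]
      push_cast
      simp only [zero_sub]
      ring
    rw [e, norm_mul, Complex.norm_exp_ofReal_mul_I, one_mul]
    have h0 := hp 0
    have hj0 := hp j
    have hsq := sin_sq_le_one (j * θ / 2)
    have hsq0 := sq_nonneg (sin (j * θ / 2))
    have hP : 0 ≤ p 0 * p j := mul_nonneg h0 hj0
    have hP' : 2 * (p 0 * p j) ≤ p 0 + p j := by nlinarith
    have hc : cos (j * θ) = 1 - 2 * sin (j * θ / 2) ^ 2 := by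
      have := cos_two_mul (j * θ / 2)
      rw [show 2 * (j * θ / 2) = j * θ by ring] at this
      rw [this, cos_sq']; ring
    refine abs_le_of_sq_le_sq' ?_ (by nlinarith) |>.2
    rw [Complex.sq_norm, Complex.normSq_add_mul_I, mul_pow, sin_sq, hc]
    set q := sin (j * θ / 2) ^ 2
    nlinarith [mul_nonneg (mul_nonneg hP hsq0) (sub_nonneg.2 hS), sq_nonneg (p 0 * p j * q)]
  rw [← hs1]
  refine (norm_add_le _ _).trans ?_
  linarith

/-- Both functions are compared with `1 - vθ²/2`. Centering kills the linear Taylor term and the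
cubic remainder costs `4T`; the Gaussian differs by at most `v²θ⁴/4`, where one `|θ|` is bounded by
`π`. -/
theorem norm_centeredCharFn_sub_exp_le {v T : ℝ} (hm : HasSum (fun j : ℕ => ((j : ℝ) - m) * p j) 0)
    (hv : HasSum (fun j : ℕ => ((j : ℝ) - m) ^ 2 * p j) v)
    (hT : HasSum (fun j : ℕ => |(j : ℝ) - m| ^ 3 * p j) T) {θ : ℝ} (hθ : |θ| ≤ π) :
    ‖centeredCharFn p m θ - (exp (-(v / 2) * θ ^ 2) : ℝ)‖ ≤
      (4 * T + v ^ 2 * π / 4) * |θ| ^ 3 := by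
  have hv0 : 0 ≤ v := hv.nonneg fun j => mul_nonneg (sq_nonneg _) (hp j)
  have hquad : HasSum (fun j : ℕ => (p j : ℂ) * (1 + (((j : ℝ) - m) * θ : ℝ) * Complex.I -
      ((((j : ℝ) - m) * θ : ℝ) : ℂ) ^ 2 / 2)) ((1 - v * θ ^ 2 / 2 : ℝ) : ℂ) := by
    have a1 := Complex.hasSum_ofReal.2 h1
    have a2 := (Complex.hasSum_ofReal.2 hm).mul_left (θ * Complex.I)
    have a3 := (Complex.hasSum_ofReal.2 hv).mul_left ((θ : ℂ) ^ 2 / 2)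
    refine hasSum_of_eq ((a1.add a2).sub a3) (fun j => ?_) ?_
    · push_cast; ring
    · push_cast; ring
  have hdiff := (hasSum_centeredCharFn hp h1 m θ).sub hquad
  have hb : ‖centeredCharFn p m θ - ((1 - v * θ ^ 2 / 2 : ℝ) : ℂ)‖ ≤ 4 * T * |θ| ^ 3 := by
    refine hdiff.norm_le_of_bounded
      (hasSum_of_eq (hT.mul_left (4 * |θ| ^ 3)) (fun _ => rfl) (by ring)) fun j => ?_
    rw [← mul_sub, norm_mul, Complex.norm_real, norm_of_nonneg (hp j)]
    refine (mul_le_mul_of_nonneg_left (norm_exp_mul_I_sub_quadratic_le _) (hp j)).trans (le_of_eq ?_)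
    rw [abs_mul]
    ring
  have hu : 0 ≤ v / 2 * θ ^ 2 := by positivity
  have he := abs_exp_neg_sub_le hu
  have he' : ‖((1 - v * θ ^ 2 / 2 : ℝ) : ℂ) - (exp (-(v / 2) * θ ^ 2) : ℝ)‖ ≤
      v ^ 2 * π / 4 * |θ| ^ 3 := by
    rw [← Complex.ofReal_sub, Complex.norm_real, norm_eq_abs, abs_sub_comm, neg_mul]
    rw [show 1 - v * θ ^ 2 / 2 = 1 - v / 2 * θ ^ 2 by ring]
    refine he.trans ?_
    calc (v / 2 * θ ^ 2) ^ 2 = v ^ 2 / 4 * |θ| ^ 3 * |θ| := by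
          rw [← sq_abs θ]; ring
      _ ≤ v ^ 2 / 4 * |θ| ^ 3 * π := by gcongr
      _ = _ := by ring
  calc _ = ‖(centeredCharFn p m θ - ((1 - v * θ ^ 2 / 2 : ℝ) : ℂ)) +
        (((1 - v * θ ^ 2 / 2 : ℝ) : ℂ) - (exp (-(v / 2) * θ ^ 2) : ℝ))‖ := by
        congr 1; ring
    _ ≤ 4 * T * |θ| ^ 3 + v ^ 2 * π / 4 * |θ| ^ 3 := (norm_add_le _ _).trans (add_le_add hb he')
    _ = _ := by ring

end Distribution

/-! ### Tilted distributions and the uniform local limit theorem -/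

/-- The exponentially tilted distribution on the exponents of `φ`. -/
noncomputable def tilt (φ : PowerSeries ℝ) (y : ℝ) (j : ℕ) : ℝ :=
  PowerSeries.coeff j φ * y ^ j / eval φ y

section Tilt

variable {φ : PowerSeries ℝ} (hnonneg : ∀ j : ℕ, 0 ≤ PowerSeries.coeff j φ)
  (hzero : PowerSeries.coeff 0 φ ≠ 0)
include hnonneg hzero

section Point

variable {y : ℝ} (hy : 0 < y) (hr : ENNReal.ofReal y < radius φ)
include hy hr

theorem tilt_nonneg (j : ℕ) : 0 ≤ tilt φ y j :=
  div_nonneg (mul_nonneg (hnonneg j) (pow_nonneg hy.le j))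
    (eval_pos_of_lt_radius hy hr hnonneg hzero).le

theorem hasSum_tilt : HasSum (tilt φ y) 1 := by
  have hev := eval_pos_of_lt_radius hy hr hnonneg hzero
  exact hasSum_of_eq ((hasSum_eval (momentSummable_of_lt_radius hy.le hr)).div_const (eval φ y))
    (fun _ => rfl) (div_self hev.ne').symm

theorem hasSum_tilt_center : HasSum (fun j : ℕ => ((j : ℝ) - mu φ y) * tilt φ y j) 0 := by
  have hev := eval_pos_of_lt_radius hy hr hnonneg hzero
  refine hasSum_of_eq (((hasSum_mul_mu hy hr hev.ne').div_const (eval φ y)).sub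
    ((hasSum_tilt hnonneg hzero hy hr).mul_left (mu φ y))) (fun j => ?_) ?_
  · rw [tilt]; ring
  · field_simp; ring

theorem hasSum_tilt_variance :
    HasSum (fun j : ℕ => ((j : ℝ) - mu φ y) ^ 2 * tilt φ y j) (sigmaSq φ y) := by
  have hev := eval_pos_of_lt_radius hy hr hnonneg hzero
  refine hasSum_of_eq ((hasSum_sq_mul_sigmaSq hy hr hev.ne').div_const (eval φ y)) (fun j => ?_) ?_
  · rw [tilt]; ring
  · field_simp

end Point

section Interval

variable {a b : ℝ} (ha : 0 < a) (hb : ENNReal.ofReal b < radius φ)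

omit hzero in
theorem eval_le_eval {y z : ℝ} (hy : 0 ≤ y) (hyz : y ≤ z) (hz : MomentSummable φ z) :
    eval φ y ≤ eval φ z :=
  hasSum_le (fun j => mul_le_mul_of_nonneg_left (pow_le_pow_left₀ hy hyz j) (hnonneg j))
    (hasSum_eval (hz.mono hy hyz)) (hasSum_eval hz)

include ha hb

/-- Aperiodicity bounds the characteristic functions of the tilted distributions, uniformly for
the parameter in a compact interval. -/
theorem exists_norm_centeredCharFn_tilt_le (haper : Aperiodic φ) (hab : a ≤ b) :
    ∃ c : ℝ, 0 < c ∧ ∀ y ∈ Icc a b, ∀ θ, |θ| ≤ π →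
      ‖centeredCharFn (tilt φ y) (mu φ y) θ‖ ≤ exp (-c * θ ^ 2) := by
  have hdom : ∀ y ∈ Icc a b, 0 < y ∧ ENNReal.ofReal y < radius φ := fun y hy =>
    ⟨ha.trans_le hy.1, (ENNReal.ofReal_le_ofReal hy.2).trans_lt hb⟩
  have hb0 : 0 < b := ha.trans_le hab
  have hMb := momentSummable_of_lt_radius hb0.le hb
  have hEb := eval_pos hnonneg hzero hb0.le hMb
  have h0 : 0 < PowerSeries.coeff 0 φ := (hnonneg 0).lt_of_ne' hzero
  have hle : ∀ y ∈ Icc a b, ∀ θ, ∀ j,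
      ‖centeredCharFn (tilt φ y) (mu φ y) θ‖ ≤
        1 - 2 * (tilt φ y 0 * tilt φ y j) * sin (j * θ / 2) ^ 2 := fun y hy θ j =>
    norm_centeredCharFn_le (tilt_nonneg hnonneg hzero (hdom y hy).1 (hdom y hy).2)
      (hasSum_tilt hnonneg hzero (hdom y hy).1 (hdom y hy).2) _ j θ
  have hone : ∀ y ∈ Icc a b, ∀ θ, 0 ≤ 1 - ‖centeredCharFn (tilt φ y) (mu φ y) θ‖ :=
    fun y hy θ => by
      have := hle y hy θ 0
      simp only [Nat.cast_zero, zero_mul, zero_div, sin_zero] at this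
      linarith
  have hmem : (1 : ℤ) ∈ AddSubgroup.closure
      {m : ℤ | ∃ j : ℕ, PowerSeries.coeff j φ ≠ 0 ∧ m = (j : ℤ)} := by
    rw [show AddSubgroup.closure _ = (⊤ : AddSubgroup ℤ) from haper]; trivial
  -- The integers `m` admitting such a `C` form a subgroup: closure under addition follows from the
  -- addition formula for sine. It contains every exponent of `φ`, by pairing that atom with the
  -- atom at `0`, hence contains `1`.
  have hgen : ∀ m ∈ AddSubgroup.closure
      {m : ℤ | ∃ j : ℕ, PowerSeries.coeff j φ ≠ 0 ∧ m = (j : ℤ)}, ∃ C : ℝ, 0 ≤ C ∧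
      ∀ y ∈ Icc a b, ∀ θ, sin ((m : ℝ) * θ / 2) ^ 2 ≤
        C * (1 - ‖centeredCharFn (tilt φ y) (mu φ y) θ‖) := by
    intro m hm
    induction hm using AddSubgroup.closure_induction with
    | zero => exact ⟨0, le_rfl, by simp⟩
    | mem x hx =>
      obtain ⟨j, hj, rfl⟩ := hx
      have hj0 : 0 < PowerSeries.coeff j φ := (hnonneg j).lt_of_ne' hj
      -- A lower bound for the product of the two atoms over `[a, b]`: numerator at `a`, denominator
      -- at `b`.
      set d := PowerSeries.coeff 0 φ * (PowerSeries.coeff j φ * a ^ j) / eval φ b ^ 2 with hd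
      have hd0 : 0 < d := by positivity
      refine ⟨(2 * d)⁻¹, by positivity, fun y hy θ => ?_⟩
      have hEy := eval_pos_of_lt_radius (hdom y hy).1 (hdom y hy).2 hnonneg hzero
      have hEyb := eval_le_eval hnonneg (hdom y hy).1.le hy.2 hMb
      have hdy : d ≤ tilt φ y 0 * tilt φ y j := by
        rw [tilt, tilt, hd, pow_zero, mul_one, div_mul_div_comm, ← sq]
        have hy0 := (hdom y hy).1
        have hay := hy.1
        gcongr
      have h := hle y hy θ j
      rw [inv_mul_eq_div, le_div_iff₀ (by positivity), Int.cast_natCast]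
      have := mul_le_mul_of_nonneg_right hdy (sq_nonneg (sin (j * θ / 2)))
      linarith
    | add x z _ _ hx hz =>
      obtain ⟨C, hC, h1⟩ := hx
      obtain ⟨D, hD, h2⟩ := hz
      refine ⟨2 * C + 2 * D, by positivity, fun y hy θ => ?_⟩
      have h1' := h1 y hy θ
      have h2' := h2 y hy θ
      have e : ((x + z : ℤ) : ℝ) * θ / 2 = x * θ / 2 + z * θ / 2 := by push_cast; ring
      rw [e, sin_add]
      set s := sin ((x : ℝ) * θ / 2)
      set s' := sin ((z : ℝ) * θ / 2)
      have hc := cos_sq_le_one ((x : ℝ) * θ / 2)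
      have hc' := cos_sq_le_one ((z : ℝ) * θ / 2)
      set u := cos ((x : ℝ) * θ / 2)
      set u' := cos ((z : ℝ) * θ / 2)
      have i1 : (s * u' + u * s') ^ 2 ≤ 2 * (s * u') ^ 2 + 2 * (u * s') ^ 2 := by
        nlinarith [sq_nonneg (s * u' - u * s')]
      have i2 : (s * u') ^ 2 ≤ s ^ 2 := by
        rw [mul_pow]; exact mul_le_of_le_one_right (sq_nonneg _) hc'
      have i3 : (u * s') ^ 2 ≤ s' ^ 2 := by
        rw [mul_pow]; exact mul_le_of_le_one_left (sq_nonneg _) hc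
      linarith
    | neg x _ hx =>
      obtain ⟨C, hC, h1⟩ := hx
      refine ⟨C, hC, fun y hy θ => ?_⟩
      have e : ((-x : ℤ) : ℝ) * θ / 2 = -(x * θ / 2) := by push_cast; ring
      rw [e, sin_neg, neg_sq]
      exact h1 y hy θ
  obtain ⟨C, hC, h⟩ := hgen 1 hmem
  -- Jordan's inequality gives `|sin(θ/2)| ≥ |θ|/π`; then `1 - x ≤ exp(-x)` concludes. `C + 1`
  -- avoids division by zero.
  refine ⟨((C + 1) * π ^ 2)⁻¹, by positivity, fun y hy θ hθ => ?_⟩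
  have h1 := h y hy θ
  have hx := hone y hy θ
  have h2 : 2 / π * |θ / 2| ≤ |sin (θ / 2)| :=
    mul_abs_le_abs_sin (by rw [abs_div, abs_two]; linarith)
  have h3 : θ ^ 2 / π ^ 2 ≤ sin (θ / 2) ^ 2 := by
    rw [← sq_abs (sin _)]
    refine le_trans (le_of_eq ?_) (pow_le_pow_left₀ (by positivity) h2 2)
    rw [abs_div, abs_two, mul_pow, div_pow, div_pow, sq_abs]
    ring
  simp only [Int.cast_one, one_mul] at h1
  have h4 : θ ^ 2 / π ^ 2 ≤ (C + 1) * (1 - ‖centeredCharFn (tilt φ y) (mu φ y) θ‖) := by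
    linarith
  have h5 : ((C + 1) * π ^ 2)⁻¹ * θ ^ 2 ≤ 1 - ‖centeredCharFn (tilt φ y) (mu φ y) θ‖ := by
    have : ((C + 1) * π ^ 2)⁻¹ * θ ^ 2 = θ ^ 2 / π ^ 2 / (C + 1) := by field_simp
    rw [this, div_le_iff₀ (by positivity)]
    linarith
  have := add_one_le_exp (-((C + 1) * π ^ 2)⁻¹ * θ ^ 2)
  linarith

theorem exists_hasSum_third_moment_le (hab : a ≤ b)
    (hdeg : ∃ j : ℕ, 2 ≤ j ∧ PowerSeries.coeff j φ ≠ 0) :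
    ∃ T : ℝ, 0 ≤ T ∧ ∀ y ∈ Icc a b, ∃ S ≤ T,
      HasSum (fun j : ℕ => |(j : ℝ) - mu φ y| ^ 3 * tilt φ y j) S := by
  have hb0 : 0 < b := ha.trans_le hab
  have hdom : ∀ y ∈ Icc a b, 0 < y ∧ ENNReal.ofReal y < radius φ := fun y hy =>
    ⟨ha.trans_le hy.1, (ENNReal.ofReal_le_ofReal hy.2).trans_lt hb⟩
  have hMb := momentSummable_of_lt_radius hb0.le hb
  have h0 : 0 < PowerSeries.coeff 0 φ := (hnonneg 0).lt_of_ne' hzero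
  set M := mu φ b
  have hM0 : 0 < M := mu_pos hb0 hb hnonneg hzero hdeg
  -- A majorant free of `y`, from `|j - μ(y)| ≤ j + μ(b)`, `y ≤ b` and `φ(y) ≥ φ₀`.
  set g : ℕ → ℝ := fun j =>
    ((j : ℝ) + M) ^ 3 * (PowerSeries.coeff j φ * b ^ j) / PowerSeries.coeff 0 φ with hg
  have hgs : Summable g := by
    refine Summable.div_const ?_ _
    refine ((((hMb 3).add ((hMb 2).mul_left (3 * M))).add ((hMb 1).mul_left (3 * M ^ 2))).add
      ((hMb 0).mul_left (M ^ 3))).congr fun j => ?_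
    rw [abs_of_nonneg (hnonneg j)]
    ring
  have hg0 : ∀ j, 0 ≤ g j := fun j => by
    have := hnonneg j
    rw [hg]; positivity
  refine ⟨∑' j, g j, tsum_nonneg hg0, fun y hy => ?_⟩
  obtain ⟨hy0, hyr⟩ := hdom y hy
  have hmy : mu φ y ≤ M := (strictMonoOn_mu hnonneg hzero hdeg).monotoneOn ⟨hy0, hyr⟩ ⟨hb0, hb⟩ hy.2
  have hmy0 := mu_pos hy0 hyr hnonneg hzero hdeg
  have hEy := coeff_zero_le_eval hnonneg hy0.le (momentSummable_of_lt_radius hy0.le hyr)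
  have hbd : ∀ j : ℕ, |(j : ℝ) - mu φ y| ^ 3 * tilt φ y j ≤ g j := fun j => by
    have hj : |(j : ℝ) - mu φ y| ≤ (j : ℝ) + M := by
      have : (0 : ℝ) ≤ j := Nat.cast_nonneg j
      rw [abs_le]; constructor <;> linarith
    have := hnonneg j
    rw [tilt, ← mul_div_assoc, hg]
    beta_reduce
    have := hy.2
    gcongr
  have hs : Summable (fun j : ℕ => |(j : ℝ) - mu φ y| ^ 3 * tilt φ y j) :=
    hgs.of_nonneg_of_le
      (fun j => mul_nonneg (by positivity) (tilt_nonneg hnonneg hzero hy0 hyr j)) hbd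
  exact ⟨_, hs.tsum_le_tsum hbd hgs, hs.hasSum⟩

/-- The uniform local limit theorem at the mean, for the tilted distributions. -/
theorem exists_norm_integral_centeredCharFn_sub_le (haper : Aperiodic φ) (hab : a ≤ b)
    (hdeg : ∃ j : ℕ, 2 ≤ j ∧ PowerSeries.coeff j φ ≠ 0) :
    ∃ C S : ℝ, 0 ≤ C ∧ 0 ≤ S ∧ ∀ y ∈ Icc a b, sigmaSq φ y ≤ S ∧ ∀ n : ℕ, 0 < n →
      ‖(∫ θ in (-π)..π, centeredCharFn (tilt φ y) (mu φ y) θ ^ n) -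
        (√(2 * π / (n * sigmaSq φ y)) : ℝ)‖ ≤ C / n := by
  have hb0 : 0 < b := ha.trans_le hab
  have hdom : ∀ y ∈ Icc a b, 0 < y ∧ ENNReal.ofReal y < radius φ := fun y hy =>
    ⟨ha.trans_le hy.1, (ENNReal.ofReal_le_ofReal hy.2).trans_lt hb⟩
  have hMb := momentSummable_of_lt_radius hb0.le hb
  have hEb := eval_pos hnonneg hzero hb0.le hMb
  have h0 : 0 < PowerSeries.coeff 0 φ := (hnonneg 0).lt_of_ne' hzero
  have hma : 0 < mu φ a :=
    mu_pos ha (hdom a ⟨le_rfl, hab⟩).2 hnonneg hzero hdeg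
  obtain ⟨c₁, hc₁, hχ⟩ := exists_norm_centeredCharFn_tilt_le hnonneg hzero ha hb haper hab
  obtain ⟨T, hT, hthird⟩ := exists_hasSum_third_moment_le hnonneg hzero ha hb hab hdeg
  -- The atom at `0` gives `σ²(y) ≥ φ₀ μ(y)²/φ(y)`, which is at least `V` by monotonicity of `μ` and
  -- `φ`.
  set V := PowerSeries.coeff 0 φ * mu φ a ^ 2 / eval φ b with hV
  have hV0 : 0 < V := by positivity
  set c := min c₁ (V / 2) with hc
  have hc0 : 0 < c := lt_min hc₁ (by positivity)
  obtain ⟨C, hC, hint⟩ := exists_norm_integral_pow_sub_le hc0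
    (by positivity : 0 ≤ 4 * T + (1 + T) ^ 2 * π / 4)
  refine ⟨C, 1 + T, hC, by positivity, fun y hy => ?_⟩
  obtain ⟨hy0, hyr⟩ := hdom y hy
  have hp := tilt_nonneg hnonneg hzero hy0 hyr
  have h1 := hasSum_tilt hnonneg hzero hy0 hyr
  have hvar := hasSum_tilt_variance hnonneg hzero hy0 hyr
  obtain ⟨S, hST, hS⟩ := hthird y hy
  have hs0 := sigmaSq_pos hy0 hyr hnonneg hzero hdeg
  have hsS : sigmaSq φ y ≤ 1 + T := by
    refine (hasSum_le (fun j => ?_) hvar (h1.add hS)).trans (by linarith)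
    have hx : ((j : ℝ) - mu φ y) ^ 2 ≤ 1 + |(j : ℝ) - mu φ y| ^ 3 := by
      rw [← sq_abs]
      set x := |(j : ℝ) - mu φ y|
      have hx0 : 0 ≤ x := abs_nonneg _
      rcases le_or_gt x 1 with h | h
      · have := pow_le_one₀ (n := 2) hx0 h
        have : 0 ≤ x ^ 3 := by positivity
        linarith
      · have : x ^ 2 ≤ x ^ 3 := pow_le_pow_right₀ h.le (by norm_num)
        linarith
    have := mul_le_mul_of_nonneg_right hx (hp j)
    linarith
  have hVs : 2 * c ≤ sigmaSq φ y := by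
    have h2c : 2 * c ≤ V := by linarith [min_le_right c₁ (V / 2)]
    refine h2c.trans ?_
    have hmy : mu φ a ≤ mu φ y := (strictMonoOn_mu hnonneg hzero hdeg).monotoneOn
      (hdom a ⟨le_rfl, hab⟩) ⟨hy0, hyr⟩ hy.1
    have hE := eval_le_eval hnonneg hy0.le hy.2 hMb
    have hq := coeff_zero_mul_mu_sq_le hy0 hyr hnonneg hzero
    rw [hV, div_le_iff₀ hEb]
    calc PowerSeries.coeff 0 φ * mu φ a ^ 2 ≤ PowerSeries.coeff 0 φ * mu φ y ^ 2 := by gcongr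
      _ ≤ sigmaSq φ y * eval φ y := hq
      _ ≤ _ := by gcongr
  refine ⟨hsS, hint _ _ (continuous_centeredCharFn hp h1 _) hVs (fun θ hθ => ?_) fun θ hθ => ?_⟩
  · refine (hχ y hy θ hθ).trans (exp_le_exp.2 ?_)
    have : c ≤ c₁ := min_le_left _ _
    nlinarith [sq_nonneg θ]
  · refine (norm_centeredCharFn_sub_exp_le hp h1 (mu φ y)
      (hasSum_tilt_center hnonneg hzero hy0 hyr) hvar hS hθ).trans ?_
    gcongr

end Interval

/-- Cauchy's formula for the coefficients of a power, on the circle through a point at which the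
mean is the index divided by the exponent. -/
theorem integral_centeredCharFn_pow {y : ℝ} (hy : 0 < y) (hr : ENNReal.ofReal y < radius φ)
    {n m : ℕ} (hm : n * mu φ y = m) :
    ∫ θ in (-π)..π, centeredCharFn (tilt φ y) (mu φ y) θ ^ n =
      ((2 * π * (PowerSeries.coeff m (φ ^ n) * y ^ m) / eval φ y ^ n : ℝ) : ℂ) := by
  have hE := eval_pos_of_lt_radius hy hr hnonneg hzero
  have hE' : (eval φ y : ℂ) ≠ 0 := by exact_mod_cast hE.ne'
  have hM := momentSummable_of_lt_radius hy.le hr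
  set w : PowerSeries ℂ := PowerSeries.map Complex.ofRealHom φ with hw
  have hwc : ∀ j, PowerSeries.coeff j w = ((PowerSeries.coeff j φ : ℝ) : ℂ) := fun j => by
    simp [hw]
  have hzn : ∀ θ : ℝ, ‖(y : ℂ) * Complex.exp (θ * Complex.I)‖ = y := fun θ => by
    rw [norm_mul, Complex.norm_exp_ofReal_mul_I, mul_one, Complex.norm_real, norm_of_nonneg hy.le]
  have hsum : ∀ z : ℂ, ‖z‖ = y → Summable fun j => ‖PowerSeries.coeff j w * z ^ j‖ := fun z hz => by
    refine hM.summable_abs.congr fun j => ?_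
    rw [hwc, norm_mul, norm_pow, hz, Complex.norm_real, norm_eq_abs]
  have hy' : ‖(y : ℂ)‖ = y := by rw [Complex.norm_real, norm_of_nonneg hy.le]
  have hcauchy := integral_tsum_mul_exp (summable_norm_and_tsum_coeff_pow (hsum y hy') n).1 m
  have hpt : ∀ θ : ℝ, centeredCharFn (tilt φ y) (mu φ y) θ ^ n =
      ((∑' j, PowerSeries.coeff j (w ^ n) * (y * Complex.exp (θ * Complex.I)) ^ j) *
        Complex.exp (-(m * θ * Complex.I))) / (eval φ y : ℂ) ^ n := fun θ => by
    -- Centering only contributes the phase `exp(-iμθ)`; its `n`-th power is the Cauchy kernel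
    -- `exp(-imθ)` because `nμ = m`.
    have hχ : centeredCharFn (tilt φ y) (mu φ y) θ =
        (∑' j, PowerSeries.coeff j w * (y * Complex.exp (θ * Complex.I)) ^ j) *
          (Complex.exp (-(mu φ y * θ * Complex.I)) / (eval φ y : ℂ)) := by
      rw [centeredCharFn, ← tsum_mul_right]
      refine tsum_congr fun j => ?_
      have e : Complex.exp ((((j : ℝ) - mu φ y) * θ : ℝ) * Complex.I) =
          Complex.exp (θ * Complex.I) ^ j * Complex.exp (-(mu φ y * θ * Complex.I)) := by
        rw [← Complex.exp_nat_mul, ← Complex.exp_add]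
        congr 1
        push_cast
        ring
      rw [e, hwc, tilt]
      rw [mul_pow]
      push_cast
      field_simp
    rw [hχ, mul_pow, ← (summable_norm_and_tsum_coeff_pow (hsum _ (hzn θ)) n).2, div_pow,
      ← Complex.exp_nat_mul, mul_div_assoc]
    congr 3
    have : (n : ℂ) * (mu φ y : ℂ) = m := by exact_mod_cast congrArg (fun x : ℝ => (x : ℂ)) hm
    rw [← this]
    ring
  simp only [hpt]
  rw [intervalIntegral.integral_div, hcauchy, hw, ← map_pow, PowerSeries.coeff_map]
  simp

end Tilt

/-! ### The uniform coefficient estimate -/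

/-- The main term of the asymptotic estimate. -/
noncomputable def mainTerm (φ : PowerSeries ℝ) (n k : ℕ) (y : ℝ) : ℝ :=
  ((k : ℝ) / (n : ℝ)) * eval φ y ^ n * y ^ ((k : ℤ) - (n : ℤ)) /
    √(2 * π * (n : ℝ) * sigmaSq φ y)

section Estimate

variable {φ f : PowerSeries ℝ} (hnonneg : ∀ j : ℕ, 0 ≤ PowerSeries.coeff j φ)
  (hzero : PowerSeries.coeff 0 φ ≠ 0) (hdeg : ∃ j : ℕ, 2 ≤ j ∧ PowerSeries.coeff j φ ≠ 0)
  (hf : f = PowerSeries.X * (PowerSeries.subst f φ : PowerSeries ℝ))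
include hnonneg hzero hdeg hf

/-- The equation `μ = 1 - k/n` says `nμ = n - k`, exactly the index that Lagrange inversion asks
for, so the ratio is an exact Fourier integral with no error term. -/
theorem coeff_pow_div_mainTerm {n k : ℕ} (hk : 0 < k) (hkn : k ≤ n) {y : ℝ}
    (hy : IsPositiveSolution φ (k / n) y) :
    ((PowerSeries.coeff n (f ^ k) / mainTerm φ n k y : ℝ) : ℂ) =
      (√(2 * π * n * sigmaSq φ y) / (2 * π) : ℝ) *
        ∫ θ in (-π)..π, centeredCharFn (tilt φ y) (mu φ y) θ ^ n := by
  obtain ⟨hy0, hyr, hmu⟩ := hy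
  have hn : (0 : ℝ) < n := by exact_mod_cast hk.trans_le hkn
  have hk' : (0 : ℝ) < k := by exact_mod_cast hk
  have hE := eval_pos_of_lt_radius hy0 hyr hnonneg hzero
  have hs := sigmaSq_pos hy0 hyr hnonneg hzero hdeg
  obtain ⟨m, rfl⟩ := Nat.exists_eq_add_of_le' hkn
  have hm : ((m + k : ℕ) : ℝ) * mu φ y = m := by
    rw [hmu]; field_simp; push_cast; ring
  have hlag := natCast_mul_coeff_pow_of_eq_X_mul_subst hf (m + k) k (Nat.le_add_left k m)
  rw [Nat.add_sub_cancel] at hlag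
  rw [integral_centeredCharFn_pow hnonneg hzero hy0 hyr hm, ← Complex.ofReal_mul,
    Complex.ofReal_inj, mainTerm]
  have hc : PowerSeries.coeff (m + k) (f ^ k) =
      k * PowerSeries.coeff m (φ ^ (m + k)) / ((m + k : ℕ) : ℝ) := by
    rw [eq_div_iff hn.ne', mul_comm, hlag]
  have hz : y ^ ((k : ℤ) - ((m + k : ℕ) : ℤ)) = (y ^ m)⁻¹ := by
    rw [show (k : ℤ) - ((m + k : ℕ) : ℤ) = -(m : ℤ) by push_cast; ring, zpow_neg, zpow_natCast]
  have hq : 0 < √(2 * π * ((m + k : ℕ) : ℝ) * sigmaSq φ y) := by positivity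
  rw [hc, hz]
  field_simp

/-- The estimate is uniform while the solution stays in a compact interval. -/
theorem exists_forall_abs_coeff_pow_div_mainTerm_sub_one_lt (haper : Aperiodic φ)
    {a b : ℝ} (ha : 0 < a) (hb : ENNReal.ofReal b < radius φ) (hab : a ≤ b)
    {ε : ℝ} (hε : 0 < ε) :
    ∃ N : ℕ, ∀ n k : ℕ, N ≤ n → 0 < k → k ≤ n → ∀ y ∈ Icc a b,
      IsPositiveSolution φ (k / n) y →
        |PowerSeries.coeff n (f ^ k) / mainTerm φ n k y - 1| < ε := by
  obtain ⟨C, S, hC, hS, h⟩ :=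
    exists_norm_integral_centeredCharFn_sub_le hnonneg hzero ha hb haper hab hdeg
  have hlim : Filter.Tendsto (fun n : ℕ => √(2 * π * S) * C / (2 * π) * (√(n : ℝ))⁻¹)
      Filter.atTop (nhds 0) := by
    have := (tendsto_inv_atTop_zero.comp (tendsto_sqrt_atTop.comp
      tendsto_natCast_atTop_atTop)).const_mul (√(2 * π * S) * C / (2 * π))
    simpa using! this
  obtain ⟨N, hN⟩ := Filter.eventually_atTop.1 (hlim.eventually_lt_const hε)
  refine ⟨N, fun n k hn hk hkn y hy hsol => ?_⟩
  obtain ⟨hsS, hint⟩ := h y hy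
  have hn0 : 0 < n := hk.trans_le hkn
  have hn0' : (0 : ℝ) < n := by exact_mod_cast hn0
  have hs := sigmaSq_pos hsol.1 hsol.2.1 hnonneg hzero hdeg
  have hI := hint n hn0
  have hr := coeff_pow_div_mainTerm hnonneg hzero hdeg hf hk hkn hsol
  set I := ∫ θ in (-π)..π, centeredCharFn (tilt φ y) (mu φ y) θ ^ n
  set A := √(2 * π * n * sigmaSq φ y) / (2 * π) with hA
  have hA0 : 0 ≤ A := by positivity
  -- The normalization turns the Gaussian integral into exactly `1`, so the relative error is at
  -- most `A · C/n = O(n^(-1/2))`.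
  have hone : A * √(2 * π / (n * sigmaSq φ y)) = 1 := by
    rw [hA, div_mul_eq_mul_div, ← sqrt_mul (by positivity)]
    rw [show 2 * π * n * sigmaSq φ y * (2 * π / (n * sigmaSq φ y)) = (2 * π) ^ 2 by field_simp,
      sqrt_sq (by positivity), div_self (by positivity)]
  refine lt_of_le_of_lt ?_ (hN n hn)
  calc |PowerSeries.coeff n (f ^ k) / mainTerm φ n k y - 1|
      = ‖((PowerSeries.coeff n (f ^ k) / mainTerm φ n k y : ℝ) : ℂ) - ((1 : ℝ) : ℂ)‖ := by
        rw [← Complex.ofReal_sub, Complex.norm_real, norm_eq_abs]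
    _ = A * ‖I - (√(2 * π / (n * sigmaSq φ y)) : ℝ)‖ := by
        rw [hr, ← hone, Complex.ofReal_mul, ← mul_sub, norm_mul, Complex.norm_real,
          norm_of_nonneg hA0]
    _ ≤ A * (C / n) := by gcongr
    _ ≤ √(2 * π * n * S) / (2 * π) * (C / n) := by rw [hA]; gcongr
    _ = √(2 * π * S) * C / (2 * π) * (√(n : ℝ))⁻¹ := by
        rw [show 2 * π * n * S = (2 * π * S) * n by ring, sqrt_mul (by positivity)]
        have hq : 0 < √(n : ℝ) := sqrt_pos.2 hn0'
        nth_rewrite 2 [← mul_self_sqrt hn0'.le]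
        field_simp

end Estimate

/-- The equation `μ = 1 - t` solved for `φ(y)`; it converts one form of the main term into the
other. -/
theorem eval_eq_mul_deriv_div {φ : PowerSeries ℝ} (hnonneg : ∀ j : ℕ, 0 ≤ PowerSeries.coeff j φ)
    (hzero : PowerSeries.coeff 0 φ ≠ 0) {t y : ℝ} (ht : t < 1) (hy : IsPositiveSolution φ t y) :
    eval φ y = (1 - t)⁻¹ * deriv (eval φ) y * y := by
  have hE := eval_pos_of_lt_radius hy.1 hy.2.1 hnonneg hzero
  have h := hy.2.2
  rw [mu, div_eq_iff hE.ne'] at h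
  have : 1 - t ≠ 0 := by linarith
  field_simp
  linarith

end LagrangeBivariate

/-! ### Assembly of the theorem -/

theorem mainTheorem12 (φ f : PowerSeries ℝ)
    (hrad : 0 < LagrangeBivariate.radius φ)
    (hzero : PowerSeries.coeff 0 φ ≠ 0)
    (hnonneg : ∀ j : ℕ, 0 ≤ PowerSeries.coeff j φ)
    (haper : LagrangeBivariate.Aperiodic φ)
    (hdeg : ∃ j : ℕ, 2 ≤ j ∧ PowerSeries.coeff j φ ≠ 0)
    (hf : f = PowerSeries.X * (PowerSeries.subst f φ : PowerSeries ℝ)) :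
    -- an entire series has order at least two at infinity
    (LagrangeBivariate.radius φ = ⊤ → 2 ≤ LagrangeBivariate.orderAtInfinity φ) ∧
    -- the admissible parameters are all of the unit interval once the order is at least one
    (1 ≤ LagrangeBivariate.orderAtInfinity φ →
      LagrangeBivariate.admissible φ = Ioo (0 : ℝ) 1) ∧
    -- existence and uniqueness of the positive solution, and positivity of the variance there
    (∀ t ∈ LagrangeBivariate.admissible φ,
      ∃! y : ℝ, LagrangeBivariate.IsPositiveSolution φ t y) ∧
    ∀ Y : ℝ → ℝ,
      (∀ t ∈ LagrangeBivariate.admissible φ, LagrangeBivariate.IsPositiveSolution φ t (Y t)) →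
      (∀ t ∈ LagrangeBivariate.admissible φ, 0 < LagrangeBivariate.sigmaSq φ (Y t)) ∧
      -- the uniform estimate
      (∀ K : Set ℝ, IsCompact K → K ⊆ LagrangeBivariate.admissible φ →
        ∀ ε : ℝ, 0 < ε → ∃ N : ℕ, ∀ n k : ℕ, N ≤ n → (k : ℝ) / (n : ℝ) ∈ K →
          |PowerSeries.coeff n (f ^ k) /
              (((k : ℝ) / (n : ℝ)) * LagrangeBivariate.eval φ (Y ((k : ℝ) / (n : ℝ))) ^ n *
                Y ((k : ℝ) / (n : ℝ)) ^ ((k : ℤ) - (n : ℤ)) /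
                √(2 * Real.pi * (n : ℝ) *
                    LagrangeBivariate.sigmaSq φ (Y ((k : ℝ) / (n : ℝ))))) - 1| < ε) ∧
      -- the two forms of the main term agree
      (∀ n k : ℕ, (k : ℝ) / (n : ℝ) ∈ LagrangeBivariate.admissible φ →
        ((k : ℝ) / (n : ℝ)) * LagrangeBivariate.eval φ (Y ((k : ℝ) / (n : ℝ))) ^ n *
            Y ((k : ℝ) / (n : ℝ)) ^ ((k : ℤ) - (n : ℤ)) /
            √(2 * Real.pi * (n : ℝ) *
                LagrangeBivariate.sigmaSq φ (Y ((k : ℝ) / (n : ℝ)))) =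
          ((k : ℝ) / (n : ℝ)) * (1 - (k : ℝ) / (n : ℝ)) ^ (-(n : ℤ)) *
            deriv (LagrangeBivariate.eval φ) (Y ((k : ℝ) / (n : ℝ))) ^ n *
            Y ((k : ℝ) / (n : ℝ)) ^ k /
            √(2 * Real.pi * (n : ℝ) *
                LagrangeBivariate.sigmaSq φ (Y ((k : ℝ) / (n : ℝ))))) := by
  open LagrangeBivariate in
  refine ⟨two_le_orderAtInfinity hnonneg hzero hdeg, admissible_eq_Ioo,
    fun t ht => existsUnique_isPositiveSolution hnonneg hzero hdeg ht, fun Y hY =>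
    ⟨fun t ht => sigmaSq_pos (hY t ht).1 (hY t ht).2.1 hnonneg hzero hdeg, ?_, ?_⟩⟩
  · intro K hK hKadm ε hε
    rcases K.eq_empty_or_nonempty with rfl | hne
    · exact ⟨0, fun n k _ h => absurd h (Set.notMem_empty _)⟩
    obtain ⟨tmin, hmin⟩ := hK.exists_isLeast hne
    obtain ⟨tmax, hmax⟩ := hK.exists_isGreatest hne
    have hmono := strictMonoOn_mu hnonneg hzero hdeg
    -- `Y` is decreasing because `μ` is increasing, so `Y` maps `K` into `[Y tmax, Y tmin]`; no
    -- continuity of `Y` is needed.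
    have hle : ∀ s ∈ K, ∀ t ∈ K, s ≤ t → Y t ≤ Y s := fun s hs t ht hst => by
      have hYs := hY s (hKadm hs)
      have hYt := hY t (hKadm ht)
      rw [← hmono.le_iff_le ⟨hYt.1, hYt.2.1⟩ ⟨hYs.1, hYs.2.1⟩, hYs.2.2, hYt.2.2]
      linarith
    obtain ⟨N, hN⟩ := exists_forall_abs_coeff_pow_div_mainTerm_sub_one_lt hnonneg hzero hdeg hf
      haper (hY tmax (hKadm hmax.1)).1 (hY tmin (hKadm hmin.1)).2.1
      (hle _ hmin.1 _ hmax.1 (hmin.2 hmax.1)) hε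
    refine ⟨N, fun n k hn hkK => ?_⟩
    obtain ⟨⟨ht0, ht1⟩, -⟩ := hKadm hkK
    -- For `n = 0` the quotient `k / n` is `0` by convention, which is not admissible.
    have hn0 : (0 : ℝ) < n := by
      rcases (Nat.cast_nonneg n : (0 : ℝ) ≤ n).eq_or_lt with h | h
      · rw [← h, div_zero] at ht0
        exact absurd ht0 (lt_irrefl _)
      · exact h
    have hk : 0 < k := by exact_mod_cast (div_pos_iff_of_pos_right hn0).1 ht0
    have hkn : k ≤ n := by
      rw [div_lt_one hn0] at ht1
      exact_mod_cast ht1.le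
    exact hN n k hn hk hkn _
      ⟨hle _ hkK _ hmax.1 (hmax.2 hkK), hle _ hmin.1 _ hkK (hmin.2 hkK)⟩ (hY _ (hKadm hkK))
  · intro n k ht
    have hsol := hY _ ht
    have hy0 : Y ((k : ℝ) / n) ≠ 0 := hsol.1.ne'
    congr 1
    nth_rewrite 1 [eval_eq_mul_deriv_div hnonneg hzero ht.1.2 hsol]
    -- The factor `yⁿ` coming from `φ(y)ⁿ` cancels the `y⁻ⁿ` in `y^(k-n)`.
    rw [mul_pow, mul_pow, zpow_sub₀ hy0, zpow_natCast, zpow_natCast, zpow_neg, zpow_natCast,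
      inv_pow]
    field_simp
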